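/- Let $A$ be a uniform algebra, i.e. a closed (not necessarily unital) subalgebra of a commutative $C^*$-algebra. An operator space structure on $A$ is a family of norms on the spaces $M_n(A)$, $n\ge 1$, that satisfies Ruan's axioms $\|v\oplus w\|=\max\{\|v\|,\|w\|\}$ and $\|\alpha v\beta\|\le\|\alpha\|\,\|v\|\,\|\beta\|$ and agrees with the given norm on $M_1(A)=A$; it turns $A$ into a completely contractive Banach algebra if $\|[a_{ij}b_{kl}]\|_{mn}\le\|a\|_m\|b\|_n$ for all $a\in M_m(A)$, $b\in M_n(A)$. The structure $\min A$ is given by $\|a\|_n=\sup\{\|[\varphi(a_{ij})]\|_{M_n(\mathbb C)}:\varphi\in A^*,\ \|\varphi\|\le 1\}$. The algebra $A$, with an operator space structure, is operator amenable if for every operator $A$-bimodule $V$ (a complete operator space $V$ with an $A$-bimodule structure whose two module actions are (jointly) completely bounded bilinear maps) every completely bounded derivation $A\to V^*$ into the dual bimodule with the dual operator space structure is inner; $A$ is amenable (in the sense of Johnson) if for every Banach $A$-bimodule $V$ every bounded derivation $A\to V^*$ is inner. Then the following are equivalent: (i) $\min A$ is operator amenable. (ii) $A$ is operator amenable for every operator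 space structure on $A$ that turns it into a completely contractive Banach algebra. (iii) $A$ is amenable. (iv) $A$ is a commutative $C^*$-algebra, i.e. $A$ is isometrically isomorphic, as a Banach algebra, to a commutative $C^*$-algebra. -/

import Mathlib

open scoped Matrix.Norms.L2Operator Kronecker

universe u

noncomputable section

instance NonUnitalSubalgebra.instNormedSpaceComplex {B : Type*} [NonUnitalNormedRing B]
    [NormedSpace ℂ B] (A : NonUnitalSubalgebra ℂ B) : NormedSpace ℂ A where
  norm_smul_le c x := norm_smul_le c (x : B)

/-! ### Norms of scalar matrices

All scalar matrices carry the operator norm between the Euclidean spaces `ℂⁿ`. -/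

section ScalarMatrices

variable {ι κ μ ν : Type*} [Fintype ι] [Fintype κ] [Fintype μ] [Fintype ν]
  [DecidableEq ι] [DecidableEq κ] [DecidableEq μ] [DecidableEq ν]

set_option linter.unusedSectionVars false

theorem sum_sq_mulVec_le (M : Matrix ι κ ℂ) (x : κ → ℂ) :
    ∑ i, ‖(M.mulVec x) i‖ ^ 2 ≤ ‖M‖ ^ 2 * ∑ j, ‖x j‖ ^ 2 := by
  have h := M.l2_opNorm_mulVec (WithLp.toLp 2 x)
  have h2 := pow_le_pow_left₀ (norm_nonneg _) h 2
  rw [mul_pow, EuclideanSpace.norm_sq_eq, EuclideanSpace.norm_sq_eq] at h2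
  exact h2

theorem opNorm_le_of_sum_sq (M : Matrix ι κ ℂ) {c : ℝ} (hc : 0 ≤ c)
    (h : ∀ x : κ → ℂ, ∑ i, ‖(M.mulVec x) i‖ ^ 2 ≤ c ^ 2 * ∑ j, ‖x j‖ ^ 2) : ‖M‖ ≤ c := by
  rw [Matrix.l2_opNorm_def]
  refine ContinuousLinearMap.opNorm_le_bound _ hc fun x => ?_
  refine (sq_le_sq₀ (norm_nonneg _) (by positivity)).mp ?_
  rw [mul_pow, EuclideanSpace.norm_sq_eq, EuclideanSpace.norm_sq_eq]
  exact h x.ofLp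

theorem norm_submatrix_equiv_le (M : Matrix ι κ ℂ) (e : μ ≃ ι) (f : ν ≃ κ) :
    ‖M.submatrix e f‖ ≤ ‖M‖ := by
  refine opNorm_le_of_sum_sq _ (norm_nonneg _) fun x => ?_
  have h := sum_sq_mulVec_le M (x ∘ f.symm)
  rw [← e.sum_comp, ← f.sum_comp] at h
  rw [Matrix.submatrix_mulVec_equiv]
  simpa using h

theorem norm_submatrix_equiv (M : Matrix ι κ ℂ) (e : μ ≃ ι) (f : ν ≃ κ) :
    ‖M.submatrix e f‖ = ‖M‖ := by
  refine le_antisymm (norm_submatrix_equiv_le M e f) ?_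
  have h := norm_submatrix_equiv_le (M.submatrix e f) e.symm f.symm
  simpa using h

theorem norm_fromBlocks_diag (A : Matrix ι ι ℂ) (D : Matrix κ κ ℂ) :
    ‖Matrix.fromBlocks A 0 0 D‖ = max ‖A‖ ‖D‖ := by
  apply le_antisymm
  · have hm : 0 ≤ max ‖A‖ ‖D‖ := le_max_of_le_left (norm_nonneg _)
    refine opNorm_le_of_sum_sq _ hm fun x => ?_
    have hA := sum_sq_mulVec_le A (x ∘ Sum.inl)
    have hD := sum_sq_mulVec_le D (x ∘ Sum.inr)
    have h1 : ‖A‖ ^ 2 ≤ (max ‖A‖ ‖D‖) ^ 2 :=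
      pow_le_pow_left₀ (norm_nonneg _) (le_max_left _ _) 2
    have h2 : ‖D‖ ^ 2 ≤ (max ‖A‖ ‖D‖) ^ 2 :=
      pow_le_pow_left₀ (norm_nonneg _) (le_max_right _ _) 2
    rw [Matrix.fromBlocks_mulVec, Fintype.sum_sum_type, Fintype.sum_sum_type, mul_add]
    simp only [Matrix.zero_mulVec, add_zero, zero_add, Sum.elim_inl, Sum.elim_inr]
    refine add_le_add (hA.trans ?_) (hD.trans ?_)
    · exact mul_le_mul_of_nonneg_right h1 (Finset.sum_nonneg fun _ _ => by positivity)
    · exact mul_le_mul_of_nonneg_right h2 (Finset.sum_nonneg fun _ _ => by positivity)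
  · refine max_le ?_ ?_
    · refine opNorm_le_of_sum_sq _ (norm_nonneg _) fun x => ?_
      have h := sum_sq_mulVec_le (Matrix.fromBlocks A 0 0 D) (Sum.elim x 0)
      rw [Matrix.fromBlocks_mulVec, Fintype.sum_sum_type, Fintype.sum_sum_type] at h
      simpa using h
    · refine opNorm_le_of_sum_sq _ (norm_nonneg _) fun x => ?_
      have h := sum_sq_mulVec_le (Matrix.fromBlocks A 0 0 D) (Sum.elim 0 x)
      rw [Matrix.fromBlocks_mulVec, Fintype.sum_sum_type, Fintype.sum_sum_type] at h
      simpa using h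

theorem norm_kronecker_one_le (A : Matrix ι κ ℂ) :
    ‖A ⊗ₖ (1 : Matrix μ μ ℂ)‖ ≤ ‖A‖ := by
  refine opNorm_le_of_sum_sq _ (norm_nonneg _) fun x => ?_
  have key : ∀ i k, ((A ⊗ₖ (1 : Matrix μ μ ℂ)).mulVec x) (i, k)
      = A.mulVec (fun j => x (j, k)) i := by
    intro i k
    simp [Matrix.mulVec, dotProduct, Fintype.sum_prod_type, Matrix.one_apply]
  rw [Fintype.sum_prod_type, Fintype.sum_prod_type, Finset.sum_comm,
    Finset.sum_comm (f := fun a b => ‖x (a, b)‖ ^ 2), Finset.mul_sum]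
  refine Finset.sum_le_sum fun k _ => ?_
  simp only [key]
  exact sum_sq_mulVec_le A fun j => x (j, k)

theorem norm_le_sum_norm (M : Matrix ι κ ℂ) : ‖M‖ ≤ ∑ i, ∑ j, ‖M i j‖ := by
  have hs : ∀ (i : ι) (j : κ) (c : ℂ), ‖Matrix.single i j c‖ ≤ ‖c‖ := by
    intro i j c
    refine opNorm_le_of_sum_sq _ (norm_nonneg _) fun x => ?_
    have : ∀ k, ‖((Matrix.single i j c).mulVec x) k‖ ^ 2
        = if k = i then ‖c‖ ^ 2 * ‖x j‖ ^ 2 else 0 := by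
      intro k
      rw [Matrix.single_mulVec]
      by_cases h : k = i
      · subst h; simp [mul_pow]
      · simp [h]
    simp only [this, Finset.sum_ite_eq', Finset.mem_univ, if_true]
    exact mul_le_mul_of_nonneg_left
      (Finset.single_le_sum (f := fun j => ‖x j‖ ^ 2) (fun _ _ => by positivity)
        (Finset.mem_univ j)) (by positivity)
  conv_lhs => rw [Matrix.matrix_eq_sum_single M]
  refine (norm_sum_le _ _).trans (Finset.sum_le_sum fun i _ => ?_)
  exact (norm_sum_le _ _).trans (Finset.sum_le_sum fun j _ => hs i j _)

end ScalarMatrices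

/-! ### Operator spaces -/

/-- The product `α v β` of a matrix `v` of vectors with scalar matrices `α`, `β`. -/
def Matrix.sandwich {ι κ : Type*} [Fintype κ] {E : Type*} [AddCommGroup E] [Module ℂ E]
    (α : Matrix ι κ ℂ) (v : Matrix κ κ E) (β : Matrix κ ι ℂ) : Matrix ι ι E :=
  Matrix.of fun i j => ∑ k, ∑ l, (α i k * β l j) • v k l

/-- The direct sum `v ⊕ w`, the block diagonal matrix of size `m + n`. -/
def Matrix.dirSum {E : Type*} [Zero E] {m n : ℕ} (v : Matrix (Fin m) (Fin m) E)
    (w : Matrix (Fin n) (Fin n) E) : Matrix (Fin (m + n)) (Fin (m + n)) E :=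
  Matrix.reindex finSumFinEquiv finSumFinEquiv (Matrix.fromBlocks v 0 0 w)

/-- An operator space structure (operator space matrix norm) on the complex normed space `E`:
norms on the spaces `M_n(E)` that satisfy Ruan's axioms and extend the given norm of
`E = M_1(E)`. That each of these seminorms is a norm follows from the axioms, see
`OperatorSpaceStructure.eq_zero_of_matrixNorm_eq_zero`. -/
@[ext]
structure OperatorSpaceStructure (E : Type*) [NormedAddCommGroup E] [NormedSpace ℂ E] where
  matrixNorm : ∀ n : ℕ, Seminorm ℂ (Matrix (Fin n) (Fin n) E)
  matrixNorm_one : ∀ x : E, matrixNorm 1 (Matrix.of fun _ _ => x) = ‖x‖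
  matrixNorm_dirSum : ∀ (m n : ℕ) (v : Matrix (Fin m) (Fin m) E) (w : Matrix (Fin n) (Fin n) E),
    matrixNorm (m + n) (v.dirSum w) = max (matrixNorm m v) (matrixNorm n w)
  matrixNorm_sandwich_le : ∀ (m n : ℕ) (α : Matrix (Fin n) (Fin m) ℂ)
    (v : Matrix (Fin m) (Fin m) E) (β : Matrix (Fin m) (Fin n) ℂ),
    matrixNorm n (α.sandwich v β) ≤ ‖α‖ * matrixNorm m v * ‖β‖

namespace OperatorSpaceStructure

section Basic

variable {E : Type*} [NormedAddCommGroup E] [NormedSpace ℂ E]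

/-- `|η v ξ| ≤ ‖η‖ ‖v‖ ‖ξ‖` for a row `η` and a column `ξ`. -/
theorem norm_row_col_le (O : OperatorSpaceStructure E) {n : ℕ} (v : Matrix (Fin n) (Fin n) E)
    (η ξ : Fin n → ℂ) {a b : ℝ} (ha : 0 ≤ a) (hb : 0 ≤ b)
    (hη : ∑ i, ‖η i‖ ^ 2 ≤ a ^ 2) (hξ : ∑ i, ‖ξ i‖ ^ 2 ≤ b ^ 2) :
    ‖∑ k, ∑ l, (η k * ξ l) • v k l‖ ≤ a * O.matrixNorm n v * b := by
  have h := O.matrixNorm_sandwich_le n 1 (Matrix.of fun _ k => η k) v (Matrix.of fun l _ => ξ l)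
  have e : (Matrix.of fun (_ : Fin 1) k => η k).sandwich v (Matrix.of fun l (_ : Fin 1) => ξ l)
      = Matrix.of fun _ _ => ∑ k, ∑ l, (η k * ξ l) • v k l := by
    ext i j; simp [Matrix.sandwich]
  rw [e, O.matrixNorm_one] at h
  have hrow : ‖(Matrix.of fun (_ : Fin 1) k => η k : Matrix (Fin 1) (Fin n) ℂ)‖ ≤ a := by
    refine opNorm_le_of_sum_sq _ ha fun x => ?_
    simp only [Finset.univ_unique, Finset.sum_singleton, Matrix.mulVec, dotProduct,
      Matrix.of_apply]
    have h1 : ‖∑ i, η i * x i‖ ≤ ∑ i, ‖η i‖ * ‖x i‖ :=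
      (norm_sum_le _ _).trans (le_of_eq (by simp))
    have h2 := Finset.sum_mul_sq_le_sq_mul_sq Finset.univ (fun i => ‖η i‖) (fun i => ‖x i‖)
    calc ‖∑ i, η i * x i‖ ^ 2 ≤ (∑ i, ‖η i‖ * ‖x i‖) ^ 2 :=
          pow_le_pow_left₀ (norm_nonneg _) h1 2
      _ ≤ (∑ i, ‖η i‖ ^ 2) * ∑ i, ‖x i‖ ^ 2 := h2
      _ ≤ a ^ 2 * ∑ i, ‖x i‖ ^ 2 :=
          mul_le_mul_of_nonneg_right hη (Finset.sum_nonneg fun _ _ => by positivity)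
  have hcol : ‖(Matrix.of fun l (_ : Fin 1) => ξ l : Matrix (Fin n) (Fin 1) ℂ)‖ ≤ b := by
    refine opNorm_le_of_sum_sq _ hb fun x => ?_
    simp only [Finset.univ_unique, Finset.sum_singleton, Matrix.mulVec, dotProduct,
      Matrix.of_apply, norm_mul, mul_pow]
    rw [← Finset.sum_mul]
    exact mul_le_mul_of_nonneg_right hξ (by positivity)
  refine h.trans ?_
  have h0 : 0 ≤ O.matrixNorm n v := apply_nonneg _ _
  gcongr

theorem norm_entry_le (O : OperatorSpaceStructure E) {n : ℕ} (v : Matrix (Fin n) (Fin n) E)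
    (i j : Fin n) : ‖v i j‖ ≤ O.matrixNorm n v := by
  have h := O.norm_row_col_le v (Pi.single i 1) (Pi.single j 1) zero_le_one zero_le_one
    (by simp [Pi.single_apply, apply_ite]) (by simp [Pi.single_apply, apply_ite])
  simpa [Pi.single_apply] using h

theorem eq_zero_of_matrixNorm_eq_zero (O : OperatorSpaceStructure E) {n : ℕ}
    {v : Matrix (Fin n) (Fin n) E} (hv : O.matrixNorm n v = 0) : v = 0 := by
  ext i j
  have h := O.norm_entry_le v i j
  rw [hv] at h
  exact norm_le_zero_iff.mp h

/-- For a bounded functional `φ`, `‖[φ(v_kl)]‖ ≤ ‖φ‖ ‖v‖`. -/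
theorem norm_map_le (O : OperatorSpaceStructure E) {n : ℕ} (v : Matrix (Fin n) (Fin n) E)
    (φ : StrongDual ℂ E) : ‖v.map φ‖ ≤ ‖φ‖ * O.matrixNorm n v := by
  have hN : 0 ≤ O.matrixNorm n v := apply_nonneg _ _
  refine opNorm_le_of_sum_sq _ (by positivity) fun ξ => ?_
  set y := (v.map φ).mulVec ξ with hy
  set S := ∑ i, ‖y i‖ ^ 2 with hS
  set X := ∑ j, ‖ξ j‖ ^ 2 with hX
  have hS0 : 0 ≤ S := Finset.sum_nonneg fun _ _ => by positivity
  have hX0 : 0 ≤ X := Finset.sum_nonneg fun _ _ => by positivity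
  have e : φ (∑ k, ∑ l, (star (y k) * ξ l) • v k l) = (S : ℂ) := by
    have : ∀ k, φ (∑ l, (star (y k) * ξ l) • v k l) = star (y k) * y k := by
      intro k
      rw [map_sum, hy]
      conv_rhs => rw [Matrix.mulVec, dotProduct, Finset.mul_sum]
      refine Finset.sum_congr rfl fun l _ => ?_
      simp only [map_smul, smul_eq_mul, Matrix.map_apply, Matrix.mulVec, dotProduct]
      ring
    rw [map_sum, hS]
    push_cast
    refine Finset.sum_congr rfl fun k _ => ?_
    rw [this k]
    exact RCLike.conj_mul (y k)
  have h := O.norm_row_col_le v (fun k => star (y k)) ξ (Real.sqrt_nonneg S)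
    (Real.sqrt_nonneg X) (by rw [Real.sq_sqrt hS0]; simp [hS]) (by rw [Real.sq_sqrt hX0])
  have h2 : S ≤ ‖φ‖ * (√S * O.matrixNorm n v * √X) := by
    calc S = ‖(S : ℂ)‖ := by simp [abs_of_nonneg hS0]
      _ ≤ _ := by
        rw [← e]
        exact (φ.le_opNorm _).trans (mul_le_mul_of_nonneg_left h (norm_nonneg _))
  have h3 : √S ≤ ‖φ‖ * O.matrixNorm n v * √X := by
    by_cases h0 : √S = 0
    · rw [h0]; positivity
    · have hpos : 0 < √S := lt_of_le_of_ne (Real.sqrt_nonneg S) (Ne.symm h0)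
      refine le_of_mul_le_mul_left ?_ hpos
      calc √S * √S = S := Real.mul_self_sqrt hS0
        _ ≤ _ := h2
        _ = _ := by ring
  calc S = √S ^ 2 := (Real.sq_sqrt hS0).symm
    _ ≤ (‖φ‖ * O.matrixNorm n v * √X) ^ 2 := pow_le_pow_left₀ (Real.sqrt_nonneg _) h3 2
    _ = _ := by rw [mul_pow, Real.sq_sqrt hX0]

/-- The pointwise supremum of a pointwise bounded family of matrix seminorms that satisfy Ruan's
axioms, provided that it gives the norm of `E` on `M_1(E)`. -/
def ofSup {ι : Type*} [Nonempty ι] (p : ι → ∀ n : ℕ, Seminorm ℂ (Matrix (Fin n) (Fin n) E))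
    (hbdd : ∀ n v, BddAbove (Set.range fun s => p s n v))
    (hone : ∀ x : E, ⨆ s, p s 1 (Matrix.of fun _ _ => x) = ‖x‖)
    (hsum : ∀ s (m n : ℕ) (v : Matrix (Fin m) (Fin m) E) (w : Matrix (Fin n) (Fin n) E),
      p s (m + n) (v.dirSum w) = max (p s m v) (p s n w))
    (hsand : ∀ s (m n : ℕ) (α : Matrix (Fin n) (Fin m) ℂ) (v : Matrix (Fin m) (Fin m) E)
      (β : Matrix (Fin m) (Fin n) ℂ), p s n (α.sandwich v β) ≤ ‖α‖ * p s m v * ‖β‖) :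
    OperatorSpaceStructure E where
  matrixNorm n := Seminorm.of (fun v => ⨆ s, p s n v)
    (fun v w => ciSup_le fun s => (map_add_le_add (p s n) v w).trans
      (add_le_add (le_ciSup (hbdd n v) s) (le_ciSup (hbdd n w) s)))
    (fun a v => by
      simp only [map_smul_eq_mul]
      exact (Real.mul_iSup_of_nonneg (norm_nonneg a) _).symm)
  matrixNorm_one := hone
  matrixNorm_dirSum m n v w := by
    change ⨆ s, p s (m + n) (v.dirSum w) = max (⨆ s, p s m v) (⨆ s, p s n w)
    simp only [hsum]
    exact ciSup_sup_eq (hbdd m v) (hbdd n w)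
  matrixNorm_sandwich_le m n α v β := by
    change ⨆ s, p s n (α.sandwich v β) ≤ ‖α‖ * (⨆ s, p s m v) * ‖β‖
    refine ciSup_le fun s => (hsand s m n α v β).trans ?_
    have := le_ciSup (hbdd m v) s
    gcongr

end Basic

/-! ### The minimal operator space structure -/

section Min

variable (E : Type*) [NormedAddCommGroup E] [NormedSpace ℂ E]

/-- The seminorm `v ↦ ‖[φ(v_ij)]‖` on `M_n(E)` given by a bounded functional `φ`. -/
def functionalSeminorm {E : Type*} [NormedAddCommGroup E] [NormedSpace ℂ E]
    (φ : StrongDual ℂ E) (n : ℕ) : Seminorm ℂ (Matrix (Fin n) (Fin n) E) :=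
  Seminorm.of (fun v => ‖v.map φ‖)
    (fun v w => by
      rw [show (v + w).map φ = v.map φ + w.map φ by ext; simp]
      exact norm_add_le _ _)
    (fun a v => by
      rw [show (a • v).map φ = a • v.map φ by ext; simp]
      exact norm_smul _ _)

/-- The minimal operator space structure:
`‖v‖ = sup { ‖[φ(v_ij)]‖ : φ ∈ E*, ‖φ‖ ≤ 1 }` for `v ∈ M_n(E)`. -/
def min : OperatorSpaceStructure E :=
  haveI : Nonempty {φ : StrongDual ℂ E // ‖φ‖ ≤ 1} := ⟨⟨0, by simp⟩⟩
  ofSup (fun (φ : {φ : StrongDual ℂ E // ‖φ‖ ≤ 1}) n => functionalSeminorm φ.1 n)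
    (by
      intro n v
      refine ⟨∑ i, ∑ j, ‖v i j‖, ?_⟩
      rintro _ ⟨φ, rfl⟩
      refine (norm_le_sum_norm _).trans
        (Finset.sum_le_sum fun i _ => Finset.sum_le_sum fun j _ => ?_)
      exact (φ.1.le_opNorm _).trans (mul_le_of_le_one_left (norm_nonneg _) φ.2))
    (by
      intro x
      have key : ∀ φ : StrongDual ℂ E,
          functionalSeminorm φ 1 (Matrix.of fun _ _ => x) = ‖φ x‖ := by
        intro φ
        change ‖(Matrix.of fun (_ _ : Fin 1) => x).map φ‖ = _
        rw [show (Matrix.of fun (_ _ : Fin 1) => x).map φ = Matrix.diagonal fun _ => φ x by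
          ext i j; simp [Subsingleton.elim i j], Matrix.l2_opNorm_diagonal]
        simp
      simp only [key]
      have hle : ∀ φ : {φ : StrongDual ℂ E // ‖φ‖ ≤ 1}, ‖φ.1 x‖ ≤ ‖x‖ := fun φ =>
        (φ.1.le_opNorm _).trans (mul_le_of_le_one_left (norm_nonneg _) φ.2)
      refine le_antisymm (ciSup_le hle) ?_
      obtain ⟨g, hg, hgx⟩ := exists_dual_vector'' ℂ x
      refine le_ciSup_of_le ⟨‖x‖, ?_⟩ ⟨g, hg⟩ ?_
      · rintro _ ⟨φ, rfl⟩
        exact hle φ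
      · simp [hgx])
    (by
      intro φ m n v w
      change ‖(v.dirSum w).map φ.1‖ = max ‖v.map φ.1‖ ‖w.map φ.1‖
      rw [← norm_fromBlocks_diag, Matrix.dirSum, Matrix.reindex_apply, ← Matrix.submatrix_map,
        norm_submatrix_equiv, Matrix.fromBlocks_map]
      simp)
    (by
      intro φ m n α v β
      change ‖(α.sandwich v β).map φ.1‖ ≤ ‖α‖ * ‖v.map φ.1‖ * ‖β‖
      have e : (α.sandwich v β).map φ.1 = α * v.map φ.1 * β := by
        ext i j
        simp only [Matrix.sandwich, Matrix.map_apply, Matrix.of_apply, map_sum, map_smul,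
          smul_eq_mul, Matrix.mul_apply, Finset.sum_mul]
        rw [Finset.sum_comm]
        exact Finset.sum_congr rfl fun l _ => Finset.sum_congr rfl fun k _ => by ring
      rw [e]
      exact (Matrix.l2_opNorm_mul _ _).trans
        (mul_le_mul_of_nonneg_right (Matrix.l2_opNorm_mul _ _) (norm_nonneg _)))

theorem min_matrixNorm {n : ℕ} (v : Matrix (Fin n) (Fin n) E) :
    (OperatorSpaceStructure.min E).matrixNorm n v
      = ⨆ φ : {φ : StrongDual ℂ E // ‖φ‖ ≤ 1}, ‖v.map φ.1‖ := rfl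

end Min

/-! ### The dual operator space -/

section Dual

variable {E : Type*} [NormedAddCommGroup E] [NormedSpace ℂ E]

/-- The scalar matrix `[f_ij(v_kl)]`, with rows `(i, k)` and columns `(j, l)`. -/
def pairing {ι κ : Type*} (f : Matrix ι ι (StrongDual ℂ E)) (v : Matrix κ κ E) :
    Matrix (ι × κ) (ι × κ) ℂ :=
  Matrix.of fun p q => f p.1 q.1 (v p.2 q.2)

/-- The seminorm `f ↦ ‖[f_ij(v_kl)]‖` on `M_n(E*)` given by a matrix `v`. -/
def pairingSeminorm {m : ℕ} (v : Matrix (Fin m) (Fin m) E) (n : ℕ) :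
    Seminorm ℂ (Matrix (Fin n) (Fin n) (StrongDual ℂ E)) :=
  Seminorm.of (fun f : Matrix (Fin n) (Fin n) (StrongDual ℂ E) => ‖pairing f v‖)
    (fun f g => by
      rw [show pairing (f + g) v = pairing f v + pairing g v by ext; simp [pairing]]
      exact norm_add_le _ _)
    (fun (a : ℂ) f => by
      rw [show pairing (a • f) v = a • pairing f v by ext; simp [pairing]]
      exact norm_smul _ _)

/-- The operator space structure of the dual `E*` of an operator space:
`‖f‖ = sup { ‖[f_ij(v_kl)]‖ : v ∈ M_m(E), ‖v‖ ≤ 1, m ∈ ℕ }` for `f ∈ M_n(E*)`, which is the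
completely bounded norm of `f : E → M_n(ℂ)`. -/
def dual (O : OperatorSpaceStructure E) : OperatorSpaceStructure (StrongDual ℂ E) :=
  haveI : Nonempty (Σ m : ℕ, {v : Matrix (Fin m) (Fin m) E // O.matrixNorm m v ≤ 1}) :=
    ⟨⟨0, 0, by simp⟩⟩
  have hone : ∀ (m : ℕ) (v : Matrix (Fin m) (Fin m) E) (φ : StrongDual ℂ E),
      pairingSeminorm v 1 (Matrix.of fun _ _ => φ) = ‖v.map φ‖ := by
    intro m v φ
    change ‖pairing (Matrix.of fun (_ _ : Fin 1) => φ) v‖ = _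
    rw [← norm_submatrix_equiv (v.map φ) (Equiv.uniqueProd (Fin m) (Fin 1))
      (Equiv.uniqueProd (Fin m) (Fin 1))]
    rfl
  have hone_le : ∀ (φ : StrongDual ℂ E)
      (s : Σ m : ℕ, {v : Matrix (Fin m) (Fin m) E // O.matrixNorm m v ≤ 1}),
      pairingSeminorm s.2.1 1 (Matrix.of fun _ _ => φ) ≤ ‖φ‖ := by
    intro φ s
    rw [hone]
    exact (O.norm_map_le s.2.1 φ).trans (mul_le_of_le_one_right (norm_nonneg _) s.2.2)
  ofSup
    (fun (s : Σ m : ℕ, {v : Matrix (Fin m) (Fin m) E // O.matrixNorm m v ≤ 1}) n =>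
      pairingSeminorm s.2.1 n)
    (by
      intro n f
      refine ⟨∑ i, ∑ j, ‖f i j‖, ?_⟩
      rintro _ ⟨s, rfl⟩
      change ‖pairing f s.2.1‖ ≤ _
      have e : pairing f s.2.1 = ∑ i, ∑ j, pairing (Matrix.single i j (f i j)) s.2.1 := by
        conv_lhs => rw [Matrix.matrix_eq_sum_single f]
        ext p q
        simp [pairing, Matrix.sum_apply]
      rw [e]
      refine (norm_sum_le _ _).trans (Finset.sum_le_sum fun i _ => ?_)
      refine (norm_sum_le _ _).trans (Finset.sum_le_sum fun j _ => ?_)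
      refine le_trans ?_ ((O.norm_map_le s.2.1 (f i j)).trans
        (mul_le_of_le_one_right (norm_nonneg _) s.2.2))
      refine opNorm_le_of_sum_sq _ (norm_nonneg _) fun x => ?_
      have h := sum_sq_mulVec_le (s.2.1.map (f i j)) (fun l => x (j, l))
      have e1 : ∀ p : Fin n × Fin s.1, ‖((pairing (Matrix.single i j (f i j)) s.2.1).mulVec x) p‖ ^ 2
          = if p.1 = i then ‖((s.2.1.map (f i j)).mulVec fun l => x (j, l)) p.2‖ ^ 2 else 0 := by
        rintro ⟨a, k⟩
        by_cases h : a = i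
        · subst h
          simp only [if_true]
          congr 2
          simp only [Matrix.mulVec, dotProduct, pairing, Matrix.of_apply, Matrix.map_apply,
            Fintype.sum_prod_type]
          rw [Finset.sum_eq_single j]
          · simp
          · intro b _ hb
            simp [hb.symm]
          · simp
        · have : ∀ q, pairing (Matrix.single i j (f i j)) s.2.1 (a, k) q = 0 := by
            intro q
            simp [pairing, Matrix.single_apply_of_row_ne (Ne.symm h)]
          simp [Matrix.mulVec, dotProduct, this, h]
      simp only [e1]
      rw [Fintype.sum_prod_type, Finset.sum_comm]
      simp only [Finset.sum_ite_eq', Finset.mem_univ, if_true]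
      refine h.trans (mul_le_mul_of_nonneg_left ?_ (by positivity))
      rw [Fintype.sum_prod_type]
      exact Finset.single_le_sum (f := fun b => ∑ l, ‖x (b, l)‖ ^ 2)
        (fun _ _ => Finset.sum_nonneg fun _ _ => by positivity) (Finset.mem_univ j))
    (by
      intro φ
      refine le_antisymm (ciSup_le (hone_le φ)) ?_
      have hb : BddAbove (Set.range fun
          (s : Σ m : ℕ, {v : Matrix (Fin m) (Fin m) E // O.matrixNorm m v ≤ 1}) =>
            pairingSeminorm s.2.1 1 (Matrix.of fun _ _ => φ)) :=
        ⟨‖φ‖, by rintro _ ⟨s, rfl⟩; exact hone_le φ s⟩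
      refine φ.opNorm_le_bound (Real.iSup_nonneg fun s => apply_nonneg _ _) fun x => ?_
      by_cases hx : x = 0
      · simp [hx]
      have hx' : 0 < ‖x‖ := norm_pos_iff.mpr hx
      have hu : O.matrixNorm 1 (Matrix.of fun _ _ => ((‖x‖⁻¹ : ℝ) : ℂ) • x) ≤ 1 := by
        rw [O.matrixNorm_one, norm_smul]
        simp [hx'.ne']
      have h := le_ciSup hb ⟨1, ⟨_, hu⟩⟩
      have h2 : ‖φ x‖ = pairingSeminorm (Matrix.of fun (_ _ : Fin 1) => ((‖x‖⁻¹ : ℝ) : ℂ) • x) 1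
          (Matrix.of fun _ _ => φ) * ‖x‖ := by
        rw [hone, show (Matrix.of fun (_ _ : Fin 1) => ((‖x‖⁻¹ : ℝ) : ℂ) • x).map φ
          = Matrix.diagonal fun _ => φ (((‖x‖⁻¹ : ℝ) : ℂ) • x) by
            ext i j; simp [Subsingleton.elim i j], Matrix.l2_opNorm_diagonal, pi_norm_const,
          map_smul, norm_smul]
        simp
        field_simp
      rw [h2]
      exact mul_le_mul_of_nonneg_right h (norm_nonneg x))
    (by
      intro s m n f g
      change ‖pairing (f.dirSum g) s.2.1‖ = max ‖pairing f s.2.1‖ ‖pairing g s.2.1‖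
      rw [← norm_fromBlocks_diag, ← norm_submatrix_equiv
        (Matrix.fromBlocks (pairing f s.2.1) 0 0 (pairing g s.2.1))
        ((Equiv.prodCongr finSumFinEquiv.symm (Equiv.refl _)).trans (Equiv.sumProdDistrib _ _ _))
        ((Equiv.prodCongr finSumFinEquiv.symm (Equiv.refl _)).trans (Equiv.sumProdDistrib _ _ _))]
      congr 1
      ext ⟨a, k⟩ ⟨b, l⟩
      obtain ⟨a, rfl⟩ := finSumFinEquiv.surjective a
      obtain ⟨b, rfl⟩ := finSumFinEquiv.surjective b
      rcases a with a | a <;> rcases b with b | b <;> simp [pairing, Matrix.dirSum])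
    (by
      intro s m n α f β
      change ‖pairing (α.sandwich f β) s.2.1‖ ≤ ‖α‖ * ‖pairing f s.2.1‖ * ‖β‖
      have e : pairing (α.sandwich f β) s.2.1 = (α ⊗ₖ (1 : Matrix (Fin s.1) (Fin s.1) ℂ))
          * pairing f s.2.1 * (β ⊗ₖ (1 : Matrix (Fin s.1) (Fin s.1) ℂ)) := by
        ext ⟨i, k⟩ ⟨j, l⟩
        simp only [pairing, Matrix.sandwich, Matrix.of_apply, Matrix.mul_apply,
          Fintype.sum_prod_type, Matrix.kroneckerMap_apply, Matrix.one_apply]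
        simp [Finset.sum_mul]
        rw [Finset.sum_comm]
        exact Finset.sum_congr rfl fun l _ => Finset.sum_congr rfl fun k _ => by ring
      rw [e]
      refine (Matrix.l2_opNorm_mul _ _).trans ?_
      refine mul_le_mul ((Matrix.l2_opNorm_mul _ _).trans ?_) (norm_kronecker_one_le β)
        (norm_nonneg _) (by positivity)
      exact mul_le_mul_of_nonneg_right (norm_kronecker_one_le α) (norm_nonneg _))

theorem dual_matrixNorm (O : OperatorSpaceStructure E) {n : ℕ}
    (f : Matrix (Fin n) (Fin n) (StrongDual ℂ E)) :
    O.dual.matrixNorm n f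
      = ⨆ s : Σ m : ℕ, {v : Matrix (Fin m) (Fin m) E // O.matrixNorm m v ≤ 1},
          ‖pairing f s.2.1‖ := rfl

end Dual

/-! ### Completely bounded maps -/

section CompletelyBounded

variable {E F G : Type*} [NormedAddCommGroup E] [NormedSpace ℂ E] [NormedAddCommGroup F]
  [NormedSpace ℂ F] [NormedAddCommGroup G] [NormedSpace ℂ G]

/-- A linear map `T : E → F` is completely bounded if `‖[T v_ij]‖ ≤ C ‖v‖` for all `n` and all
`v ∈ M_n(E)`, with one constant `C`. -/
def CompletelyBounded (OE : OperatorSpaceStructure E) (OF : OperatorSpaceStructure F)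
    (T : E →ₗ[ℂ] F) : Prop :=
  ∃ C : ℝ, ∀ (n : ℕ) (v : Matrix (Fin n) (Fin n) E),
    OF.matrixNorm n (v.map T) ≤ C * OE.matrixNorm n v

/-- The matrix `[B(v_ij, w_kl)]` of size `mn`. -/
def amplify (B : E → F → G) {m n : ℕ} (v : Matrix (Fin m) (Fin m) E)
    (w : Matrix (Fin n) (Fin n) F) : Matrix (Fin (m * n)) (Fin (m * n)) G :=
  Matrix.reindex finProdFinEquiv finProdFinEquiv
    (Matrix.of fun p q : Fin m × Fin n => B (v p.1 q.1) (w p.2 q.2))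

/-- The (jointly) completely bounded norm of the bilinear map `B : E × F → G` is at most `C`,
that is, `‖[B(v_ij, w_kl)]‖ ≤ C ‖v‖ ‖w‖` for all `v ∈ M_m(E)` and `w ∈ M_n(F)`. -/
def BilinearCBBound (OE : OperatorSpaceStructure E) (OF : OperatorSpaceStructure F)
    (OG : OperatorSpaceStructure G) (B : E → F → G) (C : ℝ) : Prop :=
  ∀ (m n : ℕ) (v : Matrix (Fin m) (Fin m) E) (w : Matrix (Fin n) (Fin n) F),
    OG.matrixNorm (m * n) (amplify B v w) ≤ C * OE.matrixNorm m v * OF.matrixNorm n w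

/-- An operator space structure on a Banach algebra `A` turns it into a completely contractive
Banach algebra if multiplication is a completely contractive bilinear map. -/
def IsCompletelyContractive {A : Type*} [NonUnitalNormedRing A] [NormedSpace ℂ A]
    (O : OperatorSpaceStructure A) : Prop :=
  BilinearCBBound O O O (fun a b : A => a * b) 1

end CompletelyBounded

end OperatorSpaceStructure

/-! ### Bimodules, derivations, amenability -/

/-- A Banach bimodule structure on the Banach space `V` over the Banach algebra `A`: bounded
bilinear actions `left a v = a • v` and `right a v = v • a` satisfying the bimodule identities. -/
structure BanachBimodule (A V : Type*) [NonUnitalNormedRing A] [NormedSpace ℂ A]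
    [NormedAddCommGroup V] [NormedSpace ℂ V] where
  left : A →L[ℂ] V →L[ℂ] V
  right : A →L[ℂ] V →L[ℂ] V
  left_mul : ∀ a b v, left (a * b) v = left a (left b v)
  right_mul : ∀ a b v, right (a * b) v = right b (right a v)
  left_right : ∀ a b v, left a (right b v) = right b (left a v)

namespace BanachBimodule

variable {A V : Type*} [NonUnitalNormedRing A] [NormedSpace ℂ A] [NormedAddCommGroup V]
  [NormedSpace ℂ V]

/-- A derivation from `A` into the dual bimodule `V*`, whose actions are
`(a • f)(v) = f(v • a)` and `(f • a)(v) = f(a • v)`: it satisfies `D(ab) = a • D(b) + D(a) • b`. -/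
def IsDualDerivation (M : BanachBimodule A V) (D : A →L[ℂ] StrongDual ℂ V) : Prop :=
  ∀ a b v, D (a * b) v = D b (M.right a v) + D a (M.left b v)

/-- The derivation `D : A → V*` is inner: `D(a) = a • f - f • a` for some `f ∈ V*`. -/
def IsInner (M : BanachBimodule A V) (D : A →L[ℂ] StrongDual ℂ V) : Prop :=
  ∃ f : StrongDual ℂ V, ∀ a v, D a v = f (M.right a v) - f (M.left a v)

/-- The bimodule is an operator bimodule for the given operator space structures on `A` and `V`:
both actions are completely bounded bilinear maps. -/
def IsOperatorBimodule (M : BanachBimodule A V) (OA : OperatorSpaceStructure A)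
    (OV : OperatorSpaceStructure V) : Prop :=
  (∃ C, OA.BilinearCBBound OV OV (fun a v => M.left a v) C) ∧
    ∃ C, OV.BilinearCBBound OA OV (fun v a => M.right a v) C

end BanachBimodule

/-- A Banach algebra is amenable (in the sense of Johnson) if every bounded derivation into the
dual of a Banach bimodule is inner. -/
def IsAmenableBanachAlgebra (A : Type u) [NonUnitalNormedRing A] [NormedSpace ℂ A] : Prop :=
  ∀ (V : Type u) [NormedAddCommGroup V] [NormedSpace ℂ V] [CompleteSpace V]
    (M : BanachBimodule A V) (D : A →L[ℂ] StrongDual ℂ V), M.IsDualDerivation D → M.IsInner D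

/-- A Banach algebra with an operator space structure is operator amenable if every completely
bounded derivation into the dual of an operator bimodule is inner. -/
def OperatorSpaceStructure.IsOperatorAmenable {A : Type u} [NonUnitalNormedRing A]
    [NormedSpace ℂ A] (O : OperatorSpaceStructure A) : Prop :=
  ∀ (V : Type u) [NormedAddCommGroup V] [NormedSpace ℂ V] [CompleteSpace V]
    (OV : OperatorSpaceStructure V) (M : BanachBimodule A V), M.IsOperatorBimodule O OV →
    ∀ D : A →L[ℂ] StrongDual ℂ V, M.IsDualDerivation D → O.CompletelyBounded OV.dual D →
      M.IsInner D

/-- The Banach algebra `A` is a commutative C*-algebra, that is, it is isometrically isomorphic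
to one as a Banach algebra. -/
def IsCommutativeCStarAlgebra (A : Type u) [NonUnitalNormedRing A] [NormedSpace ℂ A] : Prop :=
  ∃ (C : Type u) (_ : NonUnitalCommCStarAlgebra C) (φ : A →ₙₐ[ℂ] C),
    Isometry φ ∧ Function.Surjective φ

end

/-! The substance is in two implications: operator amenability of `min A` forces `A` to be
selfadjoint, and commutative C*-algebras are amenable. Amenability trivially gives operator
amenability for every structure, and `min A` is one of the structures allowed there because the
multiplicative functionals are norming on `A`.

For the first implication, embed the ambient algebra in some `C(X)` and let a functional `φ` vanish
on `A`. A positive functional `ψ` satisfies `|φ(f)|² ≤ c ψ(f* f)` (`exists_positive_dominating`), so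
`φ` is continuous for the norm of the GNS space of `ψ`, morally `L²(μ)`. Multiplication operators
represent `min A` completely contractively there, and the closure `H` of `A` is an invariant
subspace. Operator amenability yields a bounded, in general not orthogonal, projection `P` onto `H`
that commutes with `A` (`exists_commuting_projection`): the commutator with the orthogonal
projection is a derivation into the operators that kill `H` and map into `H`, and an operator
implementing it corrects the projection. Elements of `A` act as normal operators, so by Fuglede's
theorem `P` commutes with their adjoints as well. Thus `a* b` lies in `H` for `a, b ∈ A`, hence
`φ(a* b) = 0`, and Hahn–Banach gives `A* A ⊆ A`. A closed subalgebra with this property is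
selfadjoint, since `f*` is the limit of `f* (1 - (1 - b)ⁿ)` with `b = f* f / ‖f‖²`
(`star_mem_of_star_mul_mem`).

For the second implication, pass to the unitization. Its unitary group is abelian and acts on the
dual module by weak*-continuous affine maps whose common fixed points are exactly the functionals
implementing the derivation on unitaries. Markov–Kakutani provides such a point, and unitaries span
the algebra (`exists_inner_of_unital`). -/

noncomputable section

/-! ### The Markov–Kakutani fixed point theorem -/

section MarkovKakutani

open Filter Topology Pointwise

variable {E : Type*} [AddCommGroup E] [Module ℝ E] [TopologicalSpace E] [IsTopologicalAddGroup E]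
  [ContinuousSMul ℝ E] [T2Space E]

/-- A continuous affine self-map of a nonempty compact convex set has a fixed point. -/
theorem IsCompact.exists_fixedPoint_affine {K : Set E} (hK : IsCompact K) (hconv : Convex ℝ K)
    (hne : K.Nonempty) (L : E →L[ℝ] E) (c : E) (hT : ∀ x ∈ K, L x + c ∈ K) :
    ∃ x ∈ K, L x + c = x := by
  obtain ⟨x₀, hx₀⟩ := hne
  let y : ℕ → E := fun n => (fun x => L x + c)^[n] x₀
  have hy : ∀ n, y n ∈ K := fun n => by
    induction n with
    | zero => exact hx₀
    | succ n ih =>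
      simp only [y, Function.iterate_succ_apply'] at ih ⊢
      exact hT _ ih
  have hys : ∀ n, y (n + 1) = L (y n) + c := fun n => by
    simp only [y, Function.iterate_succ_apply']
  let a : ℕ → E := fun N => ∑ i ∈ Finset.range (N + 1), (1 / ((N : ℝ) + 1)) • y i
  have ha : ∀ N, a N ∈ K := fun N => by
    refine hconv.sum_mem (fun i _ => by positivity) ?_ fun i _ => hy i
    have : (N : ℝ) + 1 ≠ 0 := by positivity
    simp [this]
  -- Applying the affine map to an orbit average shifts the orbit by one, so the difference
  -- telescopes to the two endpoints.
  have hTa : ∀ N, L (a N) + c - a N = (1 / ((N : ℝ) + 1)) • (y (N + 1) - y 0) := fun N => by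
    have hN : (N : ℝ) + 1 ≠ 0 := by positivity
    have hc : c = ∑ i ∈ Finset.range (N + 1), (1 / ((N : ℝ) + 1)) • c := by
      rw [Finset.sum_const, Finset.card_range, ← Nat.cast_smul_eq_nsmul ℝ, smul_smul]
      push_cast
      rw [mul_one_div_cancel hN, one_smul]
    conv_lhs => rw [hc]
    simp only [a, map_sum, map_smul]
    rw [← Finset.sum_add_distrib, ← Finset.sum_sub_distrib, ← Finset.sum_range_sub,
      Finset.smul_sum]
    refine Finset.sum_congr rfl fun i _ => ?_
    rw [hys, smul_sub, smul_add]
  -- `K` need not be sequentially compact, so the limit of the averages is taken along an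
  -- ultrafilter.
  let U : Ultrafilter ℕ := Ultrafilter.of atTop
  obtain ⟨x, hxK, hx⟩ := hK.ultrafilter_le_nhds (U.map a) (by
    rw [Ultrafilter.coe_map, le_principal_iff, mem_map]
    exact Filter.univ_mem' ha)
  have hax : Tendsto a U (𝓝 x) := hx
  have h1 : Tendsto (fun N => L (a N) + c - a N) U (𝓝 (L x + c - x)) :=
    (((L.continuous.tendsto x).comp hax).add_const c).sub hax
  -- The endpoints differ by an element of the compact, hence bounded, set `K - K`; dividing by `N +
  -- 1` sends this to zero without any local convexity.
  have hb : Bornology.IsVonNBounded ℝ (K - K) := by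
    have h := (hK.prod hK).image (continuous_fst.sub continuous_snd)
    rw [← Set.sub_image_prod]
    exact h.isVonNBounded ℝ
  have h2 : Tendsto (fun N => L (a N) + c - a N) atTop (𝓝 0) := by
    have := hb.smul_tendsto_zero (l := atTop) (ε := fun N : ℕ => 1 / ((N : ℝ) + 1))
      (x := fun N => y (N + 1) - y 0)
      (Eventually.of_forall fun N => Set.sub_mem_sub (hy _) (hy _))
      tendsto_one_div_add_atTop_nhds_zero_nat
    refine this.congr fun N => ?_
    rw [hTa]; rfl
  have h3 := tendsto_nhds_unique h1 (h2.mono_left (Ultrafilter.of_le atTop))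
  exact ⟨x, hxK, sub_eq_zero.mp h3⟩

/-- **Markov–Kakutani**: commuting continuous affine self-maps of a nonempty compact convex set
have a common fixed point. -/
theorem IsCompact.exists_common_fixedPoint_affine {ι : Type*} {K : Set E} (hK : IsCompact K)
    (hconv : Convex ℝ K) (hne : K.Nonempty) (L : ι → E →L[ℝ] E) (c : ι → E)
    (hT : ∀ i, ∀ x ∈ K, L i x + c i ∈ K)
    (hcomm : ∀ i j x, L i (L j x + c j) + c i = L j (L i x + c i) + c j) :
    ∃ x ∈ K, ∀ i, L i x + c i = x := by
  have hcl : ∀ i, IsClosed {x | L i x + c i = x} := fun i =>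
    isClosed_eq ((L i).continuous.add_const _) continuous_id
  have hcv : ∀ i, Convex ℝ {x | L i x + c i = x} := by
    intro i x hx y hy s t _ _ hst
    simp only [Set.mem_ofPred_eq] at hx hy ⊢
    have : c i = s • c i + t • c i := by rw [← add_smul, hst, one_smul]
    rw [map_add, map_smul, map_smul, this]
    conv_rhs => rw [← hx, ← hy]
    module
  obtain ⟨x, hxK, hx⟩ := hK.inter_iInter_nonempty (fun i => {x | L i x + c i = x}) hcl (by
    classical
    intro u
    induction u using Finset.induction_on with
    | empty => simpa using hne
    | insert i u _ ih =>
      obtain ⟨x, ⟨hxK, hxu⟩, hx⟩ := IsCompact.exists_fixedPoint_affine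
        (hK.inter_right (isClosed_biInter fun j (_ : j ∈ u) => hcl j))
        (hconv.inter (convex_iInter₂ fun j _ => hcv j)) ih (L i) (c i) (by
          rintro x ⟨hxK, hxu⟩
          refine ⟨hT i x hxK, ?_⟩
          simp only [Set.mem_iInter, Set.mem_ofPred_eq] at hxu ⊢
          intro j hj
          -- A map commuting with the others preserves their common fixed point set, which is again
          -- compact and convex.
          rw [hcomm, hxu j hj])
      refine ⟨x, hxK, ?_⟩
      simp only [Set.mem_iInter, Set.mem_ofPred_eq, Finset.mem_insert] at hxu ⊢
      rintro j (rfl | hj)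
      exacts [hx, hxu j hj])
  exact ⟨x, hxK, by simpa using hx⟩

/-- The Markov–Kakutani theorem in a complex topological vector space. -/
theorem IsCompact.exists_common_fixedPoint_affine_complex {F : Type*} [AddCommGroup F] [Module ℂ F]
    [TopologicalSpace F] [IsTopologicalAddGroup F] [ContinuousSMul ℂ F] [T2Space F]
    {ι : Type*} {K : Set F} (hK : IsCompact K)
    (hconv : ∀ x ∈ K, ∀ y ∈ K, ∀ s t : ℝ, 0 ≤ s → 0 ≤ t → s + t = 1 → (s : ℂ) • x + (t : ℂ) • y ∈ K)
    (hne : K.Nonempty) (L : ι → F →L[ℂ] F) (c : ι → F)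
    (hT : ∀ i, ∀ x ∈ K, L i x + c i ∈ K)
    (hcomm : ∀ i j x, L i (L j x + c j) + c i = L j (L i x + c i) + c j) :
    ∃ x ∈ K, ∀ i, L i x + c i = x := by
  have : ContinuousSMul ℝ F :=
    ⟨(Complex.continuous_ofReal.comp continuous_fst).smul continuous_snd⟩
  exact hK.exists_common_fixedPoint_affine
    (fun x hx y hy s t hs ht hst => hconv x hx y hy s t hs ht hst) hne
    (fun i => (L i).restrictScalars ℝ) c hT hcomm

end MarkovKakutani

/-! ### Amenability of commutative C*-algebras -/

section CStarAmenable

/-- A derivation of a unital commutative C*-algebra into the dual of a unital bimodule is inner if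
the actions and the derivation are bounded on the unitaries. -/
theorem exists_inner_of_unital {U V : Type*} [CommCStarAlgebra U] [NormedAddCommGroup V]
    [NormedSpace ℂ V] (l r : U →ₗ[ℂ] V →L[ℂ] V) (D : U →ₗ[ℂ] StrongDual ℂ V)
    (l_one : ∀ v, l 1 v = v) (r_one : ∀ v, r 1 v = v)
    (l_mul : ∀ a b v, l (a * b) v = l a (l b v)) (r_mul : ∀ a b v, r (a * b) v = r b (r a v))
    (l_r : ∀ a b v, l a (r b v) = r b (l a v))
    (D_mul : ∀ a b v, D (a * b) v = D b (r a v) + D a (l b v))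
    {c d : ℝ} (hc : 0 ≤ c) (hl : ∀ u ∈ unitary U, ‖l u‖ ≤ c) (hD : ∀ u ∈ unitary U, ‖D u‖ ≤ d) :
    ∃ f : StrongDual ℂ V, ∀ a v, D a v = f (r a v) - f (l a v) := by
  have D_one : ∀ v, D 1 v = 0 := fun v => by simpa [l_one, r_one] using D_mul 1 1 v
  have l_star : ∀ u ∈ unitary U, ∀ v, l u (l (star u) v) = v := fun u hu v => by
    rw [← l_mul, (Unitary.mem_iff.mp hu).2, l_one]
  have star_l : ∀ u ∈ unitary U, ∀ v, l (star u) (l u v) = v := fun u hu v => by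
    rw [← l_mul, (Unitary.mem_iff.mp hu).1, l_one]
  -- The affine map of a unitary `u` is `f ↦ u • f • u* - D(u) • u*`; a fixed point satisfies `D(u)
  -- = u • f - f • u`, as one sees on replacing `v` by `u • v`.
  let L : U → WeakDual ℂ V →L[ℂ] WeakDual ℂ V := fun u =>
    { toFun := fun f => StrongDual.toWeakDual
        ((WeakDual.toStrongDual f).comp ((r u).comp (l (star u))))
      map_add' := fun f g => rfl
      map_smul' := fun t f => rfl
      cont := WeakDual.continuous_of_continuous_eval fun v =>
        WeakDual.eval_continuous (r u (l (star u) v)) }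
  let k : U → WeakDual ℂ V := fun u => StrongDual.toWeakDual (-(D u).comp (l (star u)))
  have hLk : ∀ u f v, (L u f + k u) v = f (r u (l (star u) v)) - D u (l (star u) v) :=
    fun u f v => (sub_eq_add_neg _ _).symm
  -- The derivation identity says that these affine maps compose like the group elements;
  -- commutativity of `U` then makes them commute.
  have hcoc : ∀ u, ∀ w ∈ unitary U, ∀ f, L u (L w f + k w) + k u = L (u * w) f + k (u * w) := by
    intro u w hw f
    refine DFunLike.ext _ _ fun v => ?_
    rw [hLk, hLk, hLk, D_mul, r_mul, star_mul, l_mul, l_star w hw, l_r, sub_sub]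
  have hd : 0 ≤ d * c :=
    mul_nonneg ((norm_nonneg _).trans (hD 1 (one_mem _))) hc
  -- The functionals whose whole orbit stays in the ball of radius `d * c`: invariance is built in
  -- through `hcoc`, and the orbit of `0` consists of the translation parts, which obey this bound.
  let K : Set (WeakDual ℂ V) := {f | ∀ u ∈ unitary U, ∀ v, ‖(L u f + k u) v‖ ≤ d * c * ‖v‖}
  have hL1 : ∀ f, L 1 f + k 1 = f := fun f => by
    refine DFunLike.ext _ _ fun v => ?_
    rw [hLk, star_one, l_one, r_one, D_one, sub_zero]
  have hKc : IsCompact K := by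
    refine (WeakDual.isCompact_closedBall (𝕜 := ℂ) (E := V) 0 (d * c)).of_isClosed_subset ?_ ?_
    · have : K = ⋂ u ∈ unitary U, ⋂ v, {f | ‖(L u f + k u) v‖ ≤ d * c * ‖v‖} := by
        ext f; simp [K]
      rw [this]
      refine isClosed_biInter fun u _ => isClosed_iInter fun v => ?_
      refine isClosed_le (continuous_norm.comp ?_) continuous_const
      exact (WeakDual.eval_continuous v).comp ((L u).continuous.add_const _)
    · intro f hf
      have h := hf 1 (one_mem _)
      rw [hL1] at h
      rw [Set.mem_preimage, mem_closedBall_zero_iff]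
      exact ContinuousLinearMap.opNorm_le_bound _ hd h
  have hKconv : ∀ f ∈ K, ∀ g ∈ K, ∀ s t : ℝ, 0 ≤ s → 0 ≤ t → s + t = 1 →
      (s : ℂ) • f + (t : ℂ) • g ∈ K := by
    intro f hf g hg s t hs ht hst u hu v
    have e : (L u ((s : ℂ) • f + (t : ℂ) • g) + k u) v
        = (s : ℂ) • (L u f + k u) v + (t : ℂ) • (L u g + k u) v := by
      rw [hLk, hLk, hLk]
      have h1 : (s : ℂ) + t = 1 := by exact_mod_cast hst
      change ((s : ℂ) • f (r u (l (star u) v)) + (t : ℂ) • g (r u (l (star u) v))) -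
        D u (l (star u) v) = (s : ℂ) • (f (r u (l (star u) v)) - D u (l (star u) v))
          + (t : ℂ) • (g (r u (l (star u) v)) - D u (l (star u) v))
      simp only [smul_eq_mul]
      linear_combination D u (l (star u) v) * h1
    rw [e]
    refine (norm_add_le _ _).trans ?_
    rw [norm_smul, norm_smul, Complex.norm_of_nonneg hs, Complex.norm_of_nonneg ht]
    calc _ ≤ s * (d * c * ‖v‖) + t * (d * c * ‖v‖) := by
          gcongr
          exacts [hf u hu v, hg u hu v]
      _ = d * c * ‖v‖ := by rw [← add_mul, hst, one_mul]
  have hK0 : K.Nonempty := ⟨0, fun u hu v => by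
    rw [hLk]
    change ‖(0 : ℂ) - D u (l (star u) v)‖ ≤ _
    rw [zero_sub, norm_neg]
    refine ((D u).le_of_opNorm_le (hD u hu) _).trans ?_
    rw [mul_assoc]
    exact mul_le_mul_of_nonneg_left
      ((l (star u)).le_of_opNorm_le (hl _ (Unitary.star_mem hu)) v)
      ((norm_nonneg _).trans (hD u hu))⟩
  obtain ⟨f, -, hf⟩ := hKc.exists_common_fixedPoint_affine_complex hKconv hK0
    (fun u : unitary U => L u) (fun u => k u)
    (fun w f hf u hu v => by rw [hcoc u w w.2]; exact hf _ (mul_mem hu w.2) v)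
    (fun u w f => by rw [hcoc _ _ w.2, hcoc _ _ u.2, mul_comm])
  have hu : ∀ u ∈ unitary U, ∀ v, D u v = f (r u v) - f (l u v) := by
    intro u hu v
    have h := DFunLike.congr_fun (hf ⟨u, hu⟩) (l u v)
    rw [hLk, star_l u hu] at h
    rw [← h, sub_sub_cancel]
  refine ⟨WeakDual.toStrongDual f, fun a v => ?_⟩
  have ha : a ∈ Submodule.span ℂ (unitary U : Set U) := by
    rw [CStarAlgebra.span_unitary]; trivial
  change D a v = f (r a v) - f (l a v)
  induction ha using Submodule.span_induction with
  | mem u h => exact hu u h v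
  | zero => simp
  | add x y _ _ hx hy =>
    simp only [map_add, add_apply, hx, hy]
    ring
  | smul t x _ hx =>
    simp only [map_smul, smul_apply, hx, smul_sub]

/-- Commutative C*-algebras are amenable. -/
theorem isAmenableBanachAlgebra_of_commCStar (C : Type u) [NonUnitalCommCStarAlgebra C] :
    IsAmenableBanachAlgebra C := by
  intro V _ _ _ M D hD
  -- The adjoined unit acts as the identity, and the derivation is extended by zero on scalars.
  let l : Unitization ℂ C →ₗ[ℂ] V →L[ℂ] V :=
    { toFun := fun a => a.fst • ContinuousLinearMap.id ℂ V + M.left a.snd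
      map_add' := fun a b => by simp only [Unitization.fst_add, Unitization.snd_add, map_add]; module
      map_smul' := fun t a => by
        simp only [Unitization.fst_smul, Unitization.snd_smul, map_smul, RingHom.id_apply]
        module }
  let r : Unitization ℂ C →ₗ[ℂ] V →L[ℂ] V :=
    { toFun := fun a => a.fst • ContinuousLinearMap.id ℂ V + M.right a.snd
      map_add' := fun a b => by simp only [Unitization.fst_add, Unitization.snd_add, map_add]; module
      map_smul' := fun t a => by
        simp only [Unitization.fst_smul, Unitization.snd_smul, map_smul, RingHom.id_apply]
        module }
  let D' : Unitization ℂ C →ₗ[ℂ] StrongDual ℂ V :=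
    { toFun := fun a => D a.snd
      map_add' := fun a b => by simp
      map_smul' := fun t a => by simp }
  have hl : ∀ a v, l a v = a.fst • v + M.left a.snd v := fun a v => rfl
  have hr : ∀ a v, r a v = a.fst • v + M.right a.snd v := fun a v => rfl
  have hD' : ∀ a, D' a = D a.snd := fun a => rfl
  -- The scalar part of a unitary has modulus one, so removing it leaves an element of norm at most
  -- `1 + 1`.
  have hsnd : ∀ u ∈ unitary (Unitization ℂ C), ‖u.fst‖ ≤ 1 ∧ ‖u.snd‖ ≤ 2 := by
    intro u hu
    have h1 : ‖u‖ ≤ 1 := CStarRing.norm_of_mem_unitary hu |>.le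
    have h2 : ‖u.fst‖ ≤ 1 := by
      have h := congrArg (fun z : Unitization ℂ C => z.fst) (Unitary.mem_iff.mp hu).1
      simp only [Unitization.fst_mul, Unitization.fst_star, Unitization.fst_one] at h
      have := congrArg norm h
      rw [norm_mul, norm_star, norm_one] at this
      nlinarith [norm_nonneg u.fst]
    refine ⟨h2, ?_⟩
    have h3 : (u.snd : Unitization ℂ C) = u - Unitization.inl u.fst := by
      conv_rhs => rw [← Unitization.inl_fst_add_inr_snd_eq u]
      simp
    calc ‖u.snd‖ = ‖(u.snd : Unitization ℂ C)‖ := (Unitization.norm_inr (𝕜 := ℂ) _).symm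
      _ ≤ ‖u‖ + ‖(Unitization.inl u.fst : Unitization ℂ C)‖ := by rw [h3]; exact norm_sub_le _ _
      _ ≤ 1 + 1 := by
        gcongr
        rw [show (Unitization.inl u.fst : Unitization ℂ C) = u.fst • 1 by
          rw [← Unitization.inl_one, ← Unitization.inl_smul, smul_eq_mul, mul_one],
          norm_smul, norm_one, mul_one]
        exact h2
      _ = 2 := by norm_num
  obtain ⟨f, hf⟩ := exists_inner_of_unital l r D' (c := 1 + ‖M.left‖ * 2) (d := ‖D‖ * 2)
    (fun v => by simp [hl]) (fun v => by simp [hr])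
    (fun a b v => by
      simp only [hl, Unitization.fst_mul, Unitization.snd_mul, map_add, map_smul,
        add_apply, smul_apply, M.left_mul]
      module)
    (fun a b v => by
      simp only [hr, Unitization.fst_mul, Unitization.snd_mul, map_add, map_smul,
        add_apply, smul_apply, M.right_mul]
      module)
    (fun a b v => by
      simp only [hl, hr, map_add, map_smul, M.left_right]
      module)
    (fun a b v => by
      have := hD a.snd b.snd v
      simp only [hD', hl, hr, Unitization.snd_mul, map_add, map_smul,
        add_apply, smul_apply, this]
      ring)
    (by positivity)
    (fun u hu => by
      refine (norm_add_le _ _).trans (add_le_add ?_ (M.left.le_opNorm_of_le (hsnd u hu).2))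
      rw [norm_smul]
      exact mul_le_one₀ (hsnd u hu).1 (norm_nonneg _) ContinuousLinearMap.norm_id_le)
    (fun u hu => D.le_opNorm_of_le (hsnd u hu).2)
  refine ⟨f, fun a v => ?_⟩
  have := hf (a : Unitization ℂ C) v
  simpa [hD', hl, hr] using this

/-- Amenability is invariant under isomorphism. -/
theorem IsAmenableBanachAlgebra.of_isometry {A C : Type u} [NonUnitalNormedRing A]
    [NormedSpace ℂ A] [NonUnitalNormedRing C] [NormedSpace ℂ C] (φ : A →ₙₐ[ℂ] C)
    (hφ : Isometry φ) (hs : Function.Surjective φ) (hC : IsAmenableBanachAlgebra C) :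
    IsAmenableBanachAlgebra A := by
  intro V _ _ _ M D hD
  let e : A ≃ₗᵢ[ℂ] C := LinearIsometryEquiv.ofSurjective
    ⟨(φ : A →ₗ[ℂ] C), fun x => hφ.norm_map_of_map_zero (map_zero φ) x⟩ hs
  have he : ∀ a, e a = φ a := fun a => rfl
  have hmul : ∀ x y, e.symm (x * y) = e.symm x * e.symm y := fun x y => by
    apply e.injective
    rw [e.apply_symm_apply, he, map_mul φ, ← he, ← he, e.apply_symm_apply, e.apply_symm_apply]
  let g : C →L[ℂ] A := e.symm.toContinuousLinearEquiv
  have hg : ∀ x, g x = e.symm x := fun x => rfl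
  obtain ⟨f, hf⟩ := hC V
    { left := M.left.comp g
      right := M.right.comp g
      left_mul := fun a b v => by simp [hg, hmul, M.left_mul]
      right_mul := fun a b v => by simp [hg, hmul, M.right_mul]
      left_right := fun a b v => by simp [M.left_right] } (D.comp g)
    (fun a b v => by simpa [hg, hmul] using hD (g a) (g b) v)
  refine ⟨f, fun a v => ?_⟩
  simpa [hg] using hf (e a) v

theorem IsCommutativeCStarAlgebra.isAmenable {A : Type u} [NonUnitalNormedRing A]
    [NormedSpace ℂ A] (h : IsCommutativeCStarAlgebra A) : IsAmenableBanachAlgebra A := by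
  obtain ⟨C, _, φ, hφ, hs⟩ := h
  exact .of_isometry φ hφ hs (isAmenableBanachAlgebra_of_commCStar C)

end CStarAmenable

/-! ### Operator spaces of operators -/

section BlockOperators

variable {ι κ μ ν : Type*} [Fintype ι] [Fintype κ] [Fintype μ] [Fintype ν]
  {K : Type*} [NormedAddCommGroup K] [NormedSpace ℂ K]

/-- The operator `K^κ → K^ι` between `ℓ²`-sums given by a matrix of operators on `K`. -/
def blockOperator : Matrix ι κ (K →L[ℂ] K) →ₗ[ℂ]
    (PiLp 2 (fun _ : κ => K) →L[ℂ] PiLp 2 (fun _ : ι => K)) where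
  toFun T := (PiLp.continuousLinearEquiv 2 ℂ (fun _ : ι => K)).symm.toContinuousLinearMap.comp
    (ContinuousLinearMap.pi fun i => ∑ j, (T i j).comp (PiLp.proj 2 (fun _ : κ => K) j))
  map_add' S T := by
    ext x i
    simp [Finset.sum_add_distrib]
  map_smul' c T := by
    ext x i
    simp [Finset.smul_sum]

theorem blockOperator_apply (T : Matrix ι κ (K →L[ℂ] K)) (x : PiLp 2 (fun _ : κ => K)) (i : ι) :
    blockOperator T x i = ∑ j, T i j (x j) := by
  simp [blockOperator]

theorem sum_sq_blockOperator_le (T : Matrix ι κ (K →L[ℂ] K)) (x : κ → K) :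
    ∑ i, ‖∑ j, T i j (x j)‖ ^ 2 ≤ ‖blockOperator T‖ ^ 2 * ∑ j, ‖x j‖ ^ 2 := by
  have h := pow_le_pow_left₀ (norm_nonneg _) ((blockOperator T).le_opNorm (WithLp.toLp 2 x)) 2
  rw [mul_pow, PiLp.norm_sq_eq_of_L2, PiLp.norm_sq_eq_of_L2] at h
  simpa only [blockOperator_apply] using h

theorem blockOperator_norm_le (T : Matrix ι κ (K →L[ℂ] K)) {c : ℝ} (hc : 0 ≤ c)
    (h : ∀ x : κ → K, ∑ i, ‖∑ j, T i j (x j)‖ ^ 2 ≤ c ^ 2 * ∑ j, ‖x j‖ ^ 2) :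
    ‖blockOperator T‖ ≤ c := by
  refine ContinuousLinearMap.opNorm_le_bound _ hc fun x => ?_
  refine (sq_le_sq₀ (norm_nonneg _) (by positivity)).mp ?_
  rw [mul_pow, PiLp.norm_sq_eq_of_L2, PiLp.norm_sq_eq_of_L2]
  simpa only [blockOperator_apply] using h x.ofLp

theorem blockOperator_norm_nonneg (T : Matrix ι κ (K →L[ℂ] K)) : 0 ≤ ‖blockOperator T‖ :=
  norm_nonneg _

theorem blockOperator_norm_add_le (S T : Matrix ι κ (K →L[ℂ] K)) :
    ‖blockOperator (S + T)‖ ≤ ‖blockOperator S‖ + ‖blockOperator T‖ := by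
  rw [map_add]
  exact norm_add_le _ _

theorem blockOperator_norm_smul (c : ℂ) (T : Matrix ι κ (K →L[ℂ] K)) :
    ‖blockOperator (c • T)‖ = ‖c‖ * ‖blockOperator T‖ := by
  rw [map_smul]
  exact norm_smul _ _

theorem blockOperator_unique [Unique ι] (T : K →L[ℂ] K) :
    ‖blockOperator (Matrix.of fun (_ _ : ι) => T)‖ = ‖T‖ := by
  refine le_antisymm (blockOperator_norm_le _ (norm_nonneg _) fun x => ?_) ?_
  · simpa [← mul_pow] using pow_le_pow_left₀ (norm_nonneg _) (T.le_opNorm (x default)) 2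
  · refine T.opNorm_le_bound (norm_nonneg _) fun y => ?_
    have h := sum_sq_blockOperator_le (Matrix.of fun (_ _ : ι) => T) (fun _ => y)
    simp only [Fintype.sum_unique, Matrix.of_apply, ← mul_pow] at h
    exact (sq_le_sq₀ (norm_nonneg _) (by positivity)).mp h

theorem blockOperator_norm_submatrix_le (T : Matrix ι κ (K →L[ℂ] K)) (e : μ ≃ ι) (f : ν ≃ κ) :
    ‖blockOperator (T.submatrix e f)‖ ≤ ‖blockOperator T‖ := by
  refine blockOperator_norm_le _ (norm_nonneg _) fun x => ?_
  have h := sum_sq_blockOperator_le T (x ∘ f.symm)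
  rw [← e.sum_comp, ← f.sum_comp] at h
  simp only [← f.sum_comp (fun j => (T _ j) _)] at h
  simpa using h

theorem blockOperator_norm_submatrix (T : Matrix ι κ (K →L[ℂ] K)) (e : μ ≃ ι) (f : ν ≃ κ) :
    ‖blockOperator (T.submatrix e f)‖ = ‖blockOperator T‖ := by
  refine le_antisymm (blockOperator_norm_submatrix_le T e f) ?_
  simpa using blockOperator_norm_submatrix_le (T.submatrix e f) e.symm f.symm

theorem blockOperator_norm_fromBlocks (S : Matrix ι ι (K →L[ℂ] K)) (T : Matrix κ κ (K →L[ℂ] K)) :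
    ‖blockOperator (Matrix.fromBlocks S 0 0 T)‖ = max ‖blockOperator S‖ ‖blockOperator T‖ := by
  apply le_antisymm
  · have hm : 0 ≤ max ‖blockOperator S‖ ‖blockOperator T‖ := le_max_of_le_left (norm_nonneg _)
    refine blockOperator_norm_le _ hm fun x => ?_
    have hS := sum_sq_blockOperator_le S (x ∘ Sum.inl)
    have hT := sum_sq_blockOperator_le T (x ∘ Sum.inr)
    simp only [Fintype.sum_sum_type, Matrix.fromBlocks_apply₁₁, Matrix.fromBlocks_apply₁₂,
      Matrix.fromBlocks_apply₂₁, Matrix.fromBlocks_apply₂₂, Matrix.zero_apply,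
      zero_apply, Finset.sum_const_zero, add_zero, zero_add, mul_add]
    refine add_le_add (hS.trans ?_) (hT.trans ?_)
    · gcongr
      exacts [le_max_left _ _, le_rfl]
    · gcongr
      exacts [le_max_right _ _, le_rfl]
  · refine max_le ?_ ?_
    · refine blockOperator_norm_le _ (norm_nonneg _) fun x => ?_
      have h := sum_sq_blockOperator_le (Matrix.fromBlocks S 0 0 T) (Sum.elim x 0)
      rw [Fintype.sum_sum_type, Fintype.sum_sum_type] at h
      simpa using h
    · refine blockOperator_norm_le _ (norm_nonneg _) fun x => ?_
      have h := sum_sq_blockOperator_le (Matrix.fromBlocks S 0 0 T) (Sum.elim 0 x)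
      rw [Fintype.sum_sum_type, Fintype.sum_sum_type] at h
      simpa using h

/-- Multiplication by a scalar matrix on vectors in `K^κ`. -/
theorem sum_sq_smul_le [DecidableEq κ] [DecidableEq ι] {K : Type*} [NormedAddCommGroup K]
    [InnerProductSpace ℂ K] (α : Matrix ι κ ℂ) (x : κ → K) :
    ∑ i, ‖∑ j, α i j • x j‖ ^ 2 ≤ ‖α‖ ^ 2 * ∑ j, ‖x j‖ ^ 2 := by
  -- Only the finite-dimensional span of the vectors matters; in an orthonormal basis of it the
  -- scalar bound applies coordinate by coordinate.
  let S : Submodule ℂ K := Submodule.span ℂ (Set.range x)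
  have : FiniteDimensional ℂ S := FiniteDimensional.span_of_finite ℂ (Set.finite_range x)
  let b := stdOrthonormalBasis ℂ S
  let y : κ → S := fun j => ⟨x j, Submodule.subset_span ⟨j, rfl⟩⟩
  have hn : ∀ z : S, ‖(z : K)‖ ^ 2 = ∑ k, ‖b.repr z k‖ ^ 2 := fun z => by
    rw [← EuclideanSpace.norm_sq_eq, b.repr.norm_map]; rfl
  have h1 : ∀ i, ‖∑ j, α i j • x j‖ ^ 2
      = ∑ k, ‖(α.mulVec fun j => b.repr (y j) k) i‖ ^ 2 := fun i => by
    rw [show ∑ j, α i j • x j = ((∑ j, α i j • y j : S) : K) by simp [y], hn]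
    simp [Matrix.mulVec, dotProduct]
  have h2 : ∀ j, ‖x j‖ ^ 2 = ∑ k, ‖b.repr (y j) k‖ ^ 2 := fun j => hn (y j)
  simp only [h1, h2]
  rw [Finset.sum_comm, Finset.sum_comm (s := Finset.univ (α := κ)), Finset.mul_sum]
  exact Finset.sum_le_sum fun k _ => sum_sq_mulVec_le α _

end BlockOperators

namespace OperatorSpaceStructure

section Operators

variable {K E : Type*} [NormedAddCommGroup K] [InnerProductSpace ℂ K] [NormedAddCommGroup E]
  [NormedSpace ℂ E]

/-- The operator space structure of a space `E` of operators on a Hilbert space `K`, embedded by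
`J`: the norm of `M_n(E)` is the operator norm on `K^n`. -/
def ofOperators (J : E →ₗᵢ[ℂ] (K →L[ℂ] K)) : OperatorSpaceStructure E where
  matrixNorm n := Seminorm.of (fun v => ‖blockOperator (v.map J)‖)
    (fun v w => by
      rw [show (v + w).map J = v.map J + w.map J by ext; simp]
      exact blockOperator_norm_add_le _ _)
    (fun a v => by
      rw [show (a • v).map J = a • v.map J by ext; simp]
      exact blockOperator_norm_smul _ _)
  matrixNorm_one x := (blockOperator_unique (ι := Fin 1) (J x)).trans (J.norm_map x)
  matrixNorm_dirSum m n v w := by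
    change ‖blockOperator ((v.dirSum w).map J)‖ = max _ _
    rw [Matrix.dirSum, Matrix.reindex_apply, ← Matrix.submatrix_map,
      blockOperator_norm_submatrix, Matrix.fromBlocks_map, Matrix.map_zero _ (map_zero J),
      Matrix.map_zero _ (map_zero J)]
    exact blockOperator_norm_fromBlocks _ _
  matrixNorm_sandwich_le m n α v β := by
    change ‖blockOperator ((α.sandwich v β).map J)‖ ≤ ‖α‖ * ‖blockOperator (v.map J)‖ * ‖β‖
    refine blockOperator_norm_le _ (by positivity) fun x => ?_
    have e : ∀ i, ∑ j, ((α.sandwich v β).map J) i j (x j)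
        = ∑ k, α i k • ∑ l, (v.map J) k l (∑ j, β l j • x j) := fun i => by
      simp only [Matrix.sandwich, Matrix.map_apply, Matrix.of_apply, map_sum, map_smul,
        Finset.smul_sum, sum_apply, smul_apply, smul_smul]
      rw [Finset.sum_comm]
      refine Finset.sum_congr rfl fun k _ => ?_
      rw [Finset.sum_comm]
    simp only [e]
    refine (sum_sq_smul_le α _).trans ?_
    rw [mul_pow, mul_pow, mul_assoc, mul_assoc]
    refine mul_le_mul_of_nonneg_left ?_ (by positivity)
    refine (sum_sq_blockOperator_le _ _).trans ?_
    exact mul_le_mul_of_nonneg_left (sum_sq_smul_le β x) (by positivity)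

theorem ofOperators_matrixNorm (J : E →ₗᵢ[ℂ] (K →L[ℂ] K)) {n : ℕ}
    (v : Matrix (Fin n) (Fin n) E) :
    (ofOperators J).matrixNorm n v = ‖blockOperator (v.map J)‖ := rfl

/-- The operator norm of `[S_ij T_kl]` is at most the product of the norms of `S` and `T`. -/
theorem blockOperator_norm_mul_le {ι κ : Type*} [Fintype ι] [Fintype κ]
    (S : Matrix ι ι (K →L[ℂ] K)) (T : Matrix κ κ (K →L[ℂ] K)) :
    ‖blockOperator (Matrix.of fun p q : ι × κ => (S p.1 q.1).comp (T p.2 q.2))‖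
      ≤ ‖blockOperator S‖ * ‖blockOperator T‖ := by
  -- The matrix factors as `(S ⊗ 1)(1 ⊗ T)`: apply the bound for `S` for each fixed second index,
  -- then the bound for `T` for each fixed first index.
  refine blockOperator_norm_le _ (by positivity) fun x => ?_
  simp only [Fintype.sum_prod_type, Matrix.of_apply, ContinuousLinearMap.comp_apply, ← map_sum]
  rw [Finset.sum_comm]
  refine (Finset.sum_le_sum fun k _ => sum_sq_blockOperator_le S _).trans ?_
  rw [← Finset.mul_sum, Finset.sum_comm, mul_pow, mul_assoc]
  refine mul_le_mul_of_nonneg_left ?_ (by positivity)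
  rw [Finset.mul_sum]
  exact Finset.sum_le_sum fun i _ => sum_sq_blockOperator_le T _

/-- The product of spaces of operators is a completely contractive bilinear map. -/
theorem bilinearCBBound_comp {G F : Type*} [NormedAddCommGroup G] [NormedSpace ℂ G]
    [NormedAddCommGroup F] [NormedSpace ℂ F] (OG : OperatorSpaceStructure G)
    (OF : OperatorSpaceStructure F) (S : G → K →L[ℂ] K) (T : F → K →L[ℂ] K)
    (hS : ∀ (n : ℕ) (v : Matrix (Fin n) (Fin n) G),
      ‖blockOperator (v.map S)‖ ≤ OG.matrixNorm n v)
    (hT : ∀ (n : ℕ) (v : Matrix (Fin n) (Fin n) F),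
      ‖blockOperator (v.map T)‖ ≤ OF.matrixNorm n v)
    (J : E →ₗᵢ[ℂ] (K →L[ℂ] K)) (B : G → F → E) (hB : ∀ e f, J (B e f) = (S e).comp (T f)) :
    OG.BilinearCBBound OF (ofOperators J) B 1 := by
  intro m n v w
  rw [one_mul, ofOperators_matrixNorm, amplify, Matrix.reindex_apply, ← Matrix.submatrix_map,
    blockOperator_norm_submatrix]
  have h := blockOperator_norm_mul_le (v.map S) (w.map T)
  refine (le_of_eq ?_).trans (h.trans (mul_le_mul (hS m v) (hT n w) (blockOperator_norm_nonneg _)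
    (apply_nonneg _ _)))
  congr 2
  ext1 p q
  exact hB _ _

end Operators

/-! ### Norming families for the minimal structure -/

section Norming

variable {E : Type*} [NormedAddCommGroup E] [NormedSpace ℂ E]

/-- The minimal matrix norms are determined by any norming family of functionals. -/
theorem min_matrixNorm_le_of_norming {X : Type*} (ev : X → StrongDual ℂ E)
    (hev : ∀ e : E, ∀ c : ℝ, 0 ≤ c → (∀ x, ‖ev x e‖ ≤ c) → ‖e‖ ≤ c) {n : ℕ}
    (v : Matrix (Fin n) (Fin n) E) {c : ℝ} (hc : 0 ≤ c) (h : ∀ x, ‖v.map (ev x)‖ ≤ c) :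
    (OperatorSpaceStructure.min E).matrixNorm n v ≤ c := by
  have : Nonempty {φ : StrongDual ℂ E // ‖φ‖ ≤ 1} := ⟨⟨0, by simp⟩⟩
  rw [min_matrixNorm]
  refine ciSup_le fun ⟨φ, hφ⟩ => opNorm_le_of_sum_sq _ hc fun ξ => ?_
  -- With `y = φ(v) ξ`, the number `‖y‖²` is `φ` of the single vector `y* v ξ` of `E`. The norming
  -- family bounds that vector by `‖y‖ c ‖ξ‖`, and one factor `‖y‖` cancels.
  set y := (v.map φ).mulVec ξ with hy
  set S := ∑ i, ‖y i‖ ^ 2 with hS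
  set N := ∑ j, ‖ξ j‖ ^ 2 with hN
  have hS0 : 0 ≤ S := Finset.sum_nonneg fun _ _ => by positivity
  have hN0 : 0 ≤ N := Finset.sum_nonneg fun _ _ => by positivity
  have key : ∀ ψ : StrongDual ℂ E, ψ (∑ k, ∑ l, (star (y k) * ξ l) • v k l)
      = ∑ k, star (y k) * (v.map ψ).mulVec ξ k := fun ψ => by
    simp only [map_sum, map_smul, smul_eq_mul, Matrix.mulVec, dotProduct, Finset.mul_sum,
      Matrix.map_apply]
    exact Finset.sum_congr rfl fun k _ => Finset.sum_congr rfl fun l _ => by ring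
  have h1 : S = ‖φ (∑ k, ∑ l, (star (y k) * ξ l) • v k l)‖ := by
    rw [key, ← hy]
    have : ∑ k, star (y k) * y k = (S : ℂ) := by
      rw [hS]
      push_cast
      exact Finset.sum_congr rfl fun k _ => RCLike.conj_mul (y k)
    rw [this, Complex.norm_of_nonneg hS0]
  have h2 : ‖∑ k, ∑ l, (star (y k) * ξ l) • v k l‖ ≤ √(S * (c ^ 2 * N)) := by
    refine hev _ _ (Real.sqrt_nonneg _) fun x => ?_
    rw [key]
    refine Real.le_sqrt_of_sq_le ?_
    have h3 : ‖∑ k, star (y k) * (v.map (ev x)).mulVec ξ k‖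
        ≤ ∑ k, ‖y k‖ * ‖(v.map (ev x)).mulVec ξ k‖ :=
      (norm_sum_le _ _).trans (le_of_eq (by simp))
    refine (pow_le_pow_left₀ (norm_nonneg _) h3 2).trans
      ((Finset.sum_mul_sq_le_sq_mul_sq _ _ _).trans ?_)
    refine mul_le_mul_of_nonneg_left ((sum_sq_mulVec_le _ ξ).trans ?_) hS0
    gcongr
    exact h x
  have h3 : S ≤ √(S * (c ^ 2 * N)) := by
    rw [h1] at hS0 ⊢
    refine ((φ.le_opNorm _).trans (mul_le_of_le_one_left (norm_nonneg _) hφ)).trans ?_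
    rwa [← h1]
  have h4 : S ^ 2 ≤ S * (c ^ 2 * N) := by
    have := pow_le_pow_left₀ hS0 h3 2
    rwa [Real.sq_sqrt (by positivity)] at this
  rcases hS0.eq_or_lt with h0 | hpos
  · rw [← h0]; positivity
  · rw [sq] at h4
    exact le_of_mul_le_mul_left h4 hpos

/-- Factor `M ⊗ N` as `(M ⊗ 1)(1 ⊗ N)`; exchanging the two indices reduces the second factor to the
form of the first. -/
theorem norm_mul_tensor_le {ι κ : Type*} [Fintype ι] [Fintype κ] [DecidableEq ι] [DecidableEq κ]
    (M : Matrix ι ι ℂ) (N : Matrix κ κ ℂ) : ‖M ⊗ₖ N‖ ≤ ‖M‖ * ‖N‖ := by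
  have e : M ⊗ₖ N = (M ⊗ₖ (1 : Matrix κ κ ℂ)) * ((1 : Matrix ι ι ℂ) ⊗ₖ N) := by
    rw [← Matrix.mul_kronecker_mul, mul_one, one_mul]
  have h : ‖(1 : Matrix ι ι ℂ) ⊗ₖ N‖ ≤ ‖N‖ := by
    refine le_trans (le_of_eq ?_) (norm_kronecker_one_le (μ := ι) N)
    rw [← norm_submatrix_equiv (N ⊗ₖ (1 : Matrix ι ι ℂ)) (Equiv.prodComm ι κ)
      (Equiv.prodComm ι κ)]
    congr 1
    ext ⟨i, k⟩ ⟨j, l⟩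
    simp [mul_comm]
  rw [e]
  exact (Matrix.l2_opNorm_mul _ _).trans
    (mul_le_mul (norm_kronecker_one_le M) h (norm_nonneg _) (norm_nonneg _))

/-- `min A` is a completely contractive Banach algebra if multiplicative functionals are norming. -/
theorem min_isCompletelyContractive {A : Type*} [NonUnitalNormedRing A] [NormedSpace ℂ A]
    {X : Type*} (ev : X → StrongDual ℂ A) (hev1 : ∀ x, ‖ev x‖ ≤ 1)
    (hmul : ∀ x a b, ev x (a * b) = ev x a * ev x b)
    (hev : ∀ e : A, ∀ c : ℝ, 0 ≤ c → (∀ x, ‖ev x e‖ ≤ c) → ‖e‖ ≤ c) :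
    (OperatorSpaceStructure.min A).IsCompletelyContractive := by
  intro m n v w
  rw [one_mul]
  have hle : ∀ x {k : ℕ} (u : Matrix (Fin k) (Fin k) A),
      ‖u.map (ev x)‖ ≤ (OperatorSpaceStructure.min A).matrixNorm k u := fun x k u =>
    (norm_map_le _ u (ev x)).trans (mul_le_of_le_one_left (apply_nonneg _ _) (hev1 x))
  refine min_matrixNorm_le_of_norming ev hev _
    (mul_nonneg (apply_nonneg _ _) (apply_nonneg _ _)) fun x => ?_
  -- Multiplicativity of the functional turns the amplified product into a Kronecker product of
  -- scalar matrices.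
  have e : (amplify (fun a b : A => a * b) v w).map (ev x)
      = (v.map (ev x) ⊗ₖ w.map (ev x)).submatrix finProdFinEquiv.symm finProdFinEquiv.symm := by
    ext p q
    simp [amplify, hmul]
  rw [e, norm_submatrix_equiv]
  exact (norm_mul_tensor_le _ _).trans
    (mul_le_mul (hle x v) (hle x w) (norm_nonneg _) (apply_nonneg _ _))

end Norming

/-! ### Actions on the dual operator space -/

section DualActions

variable {E F : Type*} [NormedAddCommGroup E] [NormedSpace ℂ E] [NormedAddCommGroup F]
  [NormedSpace ℂ F]

/-- The homogeneous form of the supremum defining the dual norm. That supremum is taken in `ℝ`, so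
its boundedness has to be established first, by splitting `f` into single entries; scaling then
needs the fact that a matrix of norm zero vanishes. -/
theorem norm_pairing_le_dual_mul (O : OperatorSpaceStructure E) {m n : ℕ}
    (f : Matrix (Fin n) (Fin n) (StrongDual ℂ E)) (v : Matrix (Fin m) (Fin m) E) :
    ‖pairing f v‖ ≤ O.dual.matrixNorm n f * O.matrixNorm m v := by
  have hb : BddAbove (Set.range fun
      (s : Σ m : ℕ, {v : Matrix (Fin m) (Fin m) E // O.matrixNorm m v ≤ 1}) =>
        ‖pairing f s.2.1‖) := by
    refine ⟨∑ i, ∑ j, ‖(Matrix.single i j 1 : Matrix (Fin n) (Fin n) ℂ)‖ * ‖f i j‖, ?_⟩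
    rintro _ ⟨s, rfl⟩
    have e : pairing f s.2.1 = ∑ i, ∑ j,
        (Matrix.single i j 1 : Matrix (Fin n) (Fin n) ℂ) ⊗ₖ s.2.1.map (f i j) := by
      ext p q
      simp [pairing, Matrix.sum_apply, Matrix.single_apply, ite_and]
    change ‖pairing f s.2.1‖ ≤ _
    rw [e]
    refine (norm_sum_le _ _).trans (Finset.sum_le_sum fun i _ => ?_)
    refine (norm_sum_le _ _).trans (Finset.sum_le_sum fun j _ => ?_)
    refine (norm_mul_tensor_le _ _).trans (mul_le_mul_of_nonneg_left ?_ (norm_nonneg _))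
    exact (O.norm_map_le s.2.1 (f i j)).trans (mul_le_of_le_one_right (norm_nonneg _) s.2.2)
  rcases (apply_nonneg (O.matrixNorm m) v).eq_or_lt with h0 | hpos
  · rw [O.eq_zero_of_matrixNorm_eq_zero h0.symm]
    rw [show pairing f (0 : Matrix (Fin m) (Fin m) E) = 0 by ext; simp [pairing]]
    simp
  · set t := O.matrixNorm m v
    have hu : O.matrixNorm m (((t⁻¹ : ℝ) : ℂ) • v) ≤ 1 := by
      rw [map_smul_eq_mul, Complex.norm_of_nonneg (by positivity)]
      exact (inv_mul_cancel₀ hpos.ne').le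
    have h : ‖pairing f (((t⁻¹ : ℝ) : ℂ) • v)‖ ≤ O.dual.matrixNorm n f := le_ciSup hb ⟨m, _, hu⟩
    rw [show pairing f (((t⁻¹ : ℝ) : ℂ) • v) = ((t⁻¹ : ℝ) : ℂ) • pairing f v by
      ext; simp [pairing], norm_smul, Complex.norm_of_nonneg (by positivity)] at h
    rwa [inv_mul_le_iff₀ hpos, mul_comm] at h

theorem dual_matrixNorm_le (O : OperatorSpaceStructure E) {n : ℕ}
    (f : Matrix (Fin n) (Fin n) (StrongDual ℂ E)) {c : ℝ}
    (h : ∀ (m : ℕ) (v : Matrix (Fin m) (Fin m) E), O.matrixNorm m v ≤ 1 → ‖pairing f v‖ ≤ c) :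
    O.dual.matrixNorm n f ≤ c := by
  have : Nonempty (Σ m : ℕ, {v : Matrix (Fin m) (Fin m) E // O.matrixNorm m v ≤ 1}) :=
    ⟨⟨0, 0, by simp⟩⟩
  rw [dual_matrixNorm]
  exact ciSup_le fun s => h s.1 s.2.1 s.2.2

/-- The left action on the dual that is adjoint to a right action is completely bounded. -/
theorem BilinearCBBound.dual_left {OE : OperatorSpaceStructure E} {OF : OperatorSpaceStructure F}
    {β : E → F → E} {c : ℝ} (hc : 0 ≤ c) (h : OE.BilinearCBBound OF OE β c)
    {lft : F → StrongDual ℂ E → StrongDual ℂ E} (hl : ∀ a φ w, lft a φ w = φ (β w a)) :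
    OF.BilinearCBBound OE.dual OE.dual lft c := by
  intro m n a φ
  refine dual_matrixNorm_le _ _ fun k w hw => ?_
  -- Moving the action from the functionals to the vectors only permutes indices. The block size is
  -- `k * m` because `β` takes the vector before the algebra element.
  let e : Fin (m * n) × Fin k ≃ Fin n × Fin (k * m) :=
    { toFun := fun p => ((finProdFinEquiv.symm p.1).2,
        finProdFinEquiv (p.2, (finProdFinEquiv.symm p.1).1))
      invFun := fun q => (finProdFinEquiv ((finProdFinEquiv.symm q.2).2, q.1),
        (finProdFinEquiv.symm q.2).1)
      left_inv := fun p => by simp [-finProdFinEquiv_symm_apply]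
      right_inv := fun q => by simp [-finProdFinEquiv_symm_apply] }
  have he : pairing (amplify lft a φ) w = (pairing φ (amplify β w a)).submatrix e e := by
    ext p q
    simp only [pairing, amplify, Matrix.reindex_apply, Matrix.submatrix_apply, Matrix.of_apply, hl,
      e, Equiv.coe_fn_mk, Equiv.symm_apply_apply]
  rw [he, norm_submatrix_equiv]
  refine (norm_pairing_le_dual_mul OE _ _).trans ?_
  have h0 : 0 ≤ OF.matrixNorm m a := apply_nonneg _ _
  have h1 : 0 ≤ OE.dual.matrixNorm n φ := apply_nonneg _ _
  have h2 : OE.matrixNorm (k * m) (amplify β w a) ≤ c * 1 * OF.matrixNorm m a :=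
    (h k m w a).trans (by gcongr)
  calc _ ≤ OE.dual.matrixNorm n φ * (c * 1 * OF.matrixNorm m a) := by gcongr
    _ = _ := by ring

/-- The right action on the dual that is adjoint to a left action is completely bounded. -/
theorem BilinearCBBound.dual_right {OE : OperatorSpaceStructure E} {OF : OperatorSpaceStructure F}
    {γ : F → E → E} {c : ℝ} (hc : 0 ≤ c) (h : OF.BilinearCBBound OE OE γ c)
    {rgt : StrongDual ℂ E → F → StrongDual ℂ E} (hr : ∀ φ a w, rgt φ a w = φ (γ a w)) :
    OE.dual.BilinearCBBound OF OE.dual rgt c := by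
  intro m n φ a
  refine dual_matrixNorm_le _ _ fun k w hw => ?_
  let e : Fin (m * n) × Fin k ≃ Fin m × Fin (n * k) :=
    { toFun := fun p => ((finProdFinEquiv.symm p.1).1,
        finProdFinEquiv ((finProdFinEquiv.symm p.1).2, p.2))
      invFun := fun q => (finProdFinEquiv (q.1, (finProdFinEquiv.symm q.2).1),
        (finProdFinEquiv.symm q.2).2)
      left_inv := fun p => by simp [-finProdFinEquiv_symm_apply]
      right_inv := fun q => by simp [-finProdFinEquiv_symm_apply] }
  have he : pairing (amplify rgt φ a) w = (pairing φ (amplify γ a w)).submatrix e e := by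
    ext p q
    simp only [pairing, amplify, Matrix.reindex_apply, Matrix.submatrix_apply, Matrix.of_apply, hr,
      e, Equiv.coe_fn_mk, Equiv.symm_apply_apply]
  rw [he, norm_submatrix_equiv]
  refine (norm_pairing_le_dual_mul OE _ _).trans ?_
  have h0 : 0 ≤ OF.matrixNorm n a := apply_nonneg _ _
  have h1 : 0 ≤ OE.dual.matrixNorm m φ := apply_nonneg _ _
  have h2 : OE.matrixNorm (n * k) (amplify γ a w) ≤ c * OF.matrixNorm n a * 1 :=
    (h n k a w).trans (by gcongr)
  calc _ ≤ OE.dual.matrixNorm m φ * (c * OF.matrixNorm n a * 1) := by gcongr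
    _ = _ := by ring

/-- A completely bounded map stays completely bounded as a map into the bidual. -/
theorem completelyBounded_bidual {OE : OperatorSpaceStructure E} {OF : OperatorSpaceStructure F}
    {T : F → E} {c : ℝ}
    (h : ∀ (n : ℕ) (v : Matrix (Fin n) (Fin n) F), OE.matrixNorm n (v.map T)
      ≤ c * OF.matrixNorm n v)
    (D : F →ₗ[ℂ] StrongDual ℂ (StrongDual ℂ E)) (hD : ∀ a φ, D a φ = φ (T a)) :
    OF.CompletelyBounded OE.dual.dual D := by
  refine ⟨c, fun n v => dual_matrixNorm_le _ _ fun k φ hφ => ?_⟩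
  -- Evaluation in the bidual exchanges the roles of the two matrices, that is, the two tensor
  -- factors.
  have he : pairing (v.map D) φ
      = (pairing φ (v.map T)).submatrix (Equiv.prodComm _ _) (Equiv.prodComm _ _) := by
    ext p q
    simp [pairing, hD]
  rw [he, norm_submatrix_equiv]
  refine (norm_pairing_le_dual_mul OE _ _).trans ?_
  exact (mul_le_of_le_one_left (apply_nonneg _ _) hφ).trans (h n v)

end DualActions

end OperatorSpaceStructure

/-! ### Invariant subspaces of operator amenable algebras -/

section InvariantSubspace

open scoped InnerProductSpace
open OperatorSpaceStructure

/-- The fixed operator `R` is treated as a matrix with one entry, so this is a case of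
`blockOperator_norm_mul_le`. -/
theorem blockOperator_norm_mul_const_le {n : ℕ} {K : Type*} [NormedAddCommGroup K]
    [InnerProductSpace ℂ K] (T : Matrix (Fin n) (Fin n) (K →L[ℂ] K)) (R : K →L[ℂ] K) :
    ‖blockOperator (Matrix.of fun i j => (T i j).comp R)‖ ≤ ‖blockOperator T‖ * ‖R‖ := by
  rw [← blockOperator_unique (ι := Fin 1) R]
  refine le_trans (le_of_eq ?_) (blockOperator_norm_mul_le T _)
  rw [← blockOperator_norm_submatrix (Matrix.of fun i j => (T i j).comp R)
    (Equiv.prodUnique (Fin n) (Fin 1)) (Equiv.prodUnique (Fin n) (Fin 1))]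
  rfl

theorem blockOperator_norm_const_mul_le {n : ℕ} {K : Type*} [NormedAddCommGroup K]
    [InnerProductSpace ℂ K] (T : Matrix (Fin n) (Fin n) (K →L[ℂ] K)) (R : K →L[ℂ] K) :
    ‖blockOperator (Matrix.of fun i j => R.comp (T i j))‖ ≤ ‖R‖ * ‖blockOperator T‖ := by
  rw [← blockOperator_unique (ι := Fin 1) R]
  refine le_trans (le_of_eq ?_) (blockOperator_norm_mul_le _ T)
  rw [← blockOperator_norm_submatrix (Matrix.of fun i j => R.comp (T i j))
    (Equiv.uniqueProd (Fin n) (Fin 1)) (Equiv.uniqueProd (Fin n) (Fin 1))]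
  rfl

-- The universe is that of `A`, since operator amenability tests only bimodules in that universe.
variable {K : Type u} [NormedAddCommGroup K] [InnerProductSpace ℂ K]

variable {E : Type u} [NormedAddCommGroup E] [NormedSpace ℂ E]

/-- The functional `e ↦ ⟪η, e ξ⟫` on a space of operators. -/
def vectorFunctional (J : E →ₗᵢ[ℂ] (K →L[ℂ] K)) (ξ η : K) : StrongDual ℂ E :=
  (innerSL ℂ η).comp ((ContinuousLinearMap.apply ℂ K ξ).comp J.toContinuousLinearMap)

theorem vectorFunctional_apply (J : E →ₗᵢ[ℂ] (K →L[ℂ] K)) (ξ η : K) (w : E) :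
    vectorFunctional J ξ η w = ⟪η, J w ξ⟫_ℂ := rfl

/-- A functional on the dual of a space of operators restricts to an operator. -/
theorem exists_operator_of_functional [CompleteSpace K] (J : E →ₗᵢ[ℂ] (K →L[ℂ] K))
    (f : StrongDual ℂ (StrongDual ℂ E)) :
    ∃ T : K →L[ℂ] K, ∀ ξ η, ⟪η, T ξ⟫_ℂ = f (vectorFunctional J ξ η) := by
  have hb : ∀ η ξ, ‖f (vectorFunctional J ξ η)‖ ≤ ‖f‖ * ‖η‖ * ‖ξ‖ := fun η ξ => by
    rw [mul_assoc]
    refine f.le_opNorm_of_le (ContinuousLinearMap.opNorm_le_bound _ (by positivity) fun w => ?_)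
    rw [vectorFunctional_apply]
    calc _ ≤ ‖η‖ * ‖J w ξ‖ := norm_inner_le_norm _ _
      _ ≤ ‖η‖ * (‖w‖ * ‖ξ‖) := by rw [← J.norm_map]; gcongr; exact (J w).le_opNorm ξ
      _ = _ := by ring
  -- Evaluating `f` on vector functionals gives a bounded sesquilinear form, which is represented by
  -- an operator.
  let B : K →ₗ⋆[ℂ] K →ₗ[ℂ] ℂ := LinearMap.mk₂'ₛₗ (starRingEnd ℂ) (RingHom.id ℂ)
    (fun η ξ => f (vectorFunctional J ξ η))
    (fun η₁ η₂ ξ => by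
      rw [← map_add]; congr 1; ext w; simp [vectorFunctional_apply])
    (fun c η ξ => by
      rw [← map_smul]; congr 1; ext w; simp [vectorFunctional_apply, mul_comm])
    (fun η ξ₁ ξ₂ => by
      rw [← map_add]; congr 1; ext w; simp [vectorFunctional_apply])
    (fun c η ξ => by
      rw [RingHom.id_apply, ← map_smul]; congr 1; ext w
      simp [vectorFunctional_apply])
  let T' := InnerProductSpace.continuousLinearMapOfBilin (B.mkContinuous₂ ‖f‖ hb)
  refine ⟨ContinuousLinearMap.adjoint T', fun ξ η => ?_⟩
  rw [ContinuousLinearMap.adjoint_inner_right,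
    InnerProductSpace.continuousLinearMapOfBilin_apply]
  rfl

/-- The space `E` in the following lemma is a copy of the space of operators that vanish on `H` and
have range in `H`. -/
theorem OperatorSpaceStructure.IsOperatorAmenable.exists_commuting_projection_aux [CompleteSpace K]
    {A : Type u} [NonUnitalNormedRing A] [NormedSpace ℂ A] {O : OperatorSpaceStructure A}
    (hO : O.IsOperatorAmenable) (S : A →ₗ[ℂ] K →L[ℂ] K)
    (hmul : ∀ a b, S (a * b) = (S a).comp (S b))
    (hcb : ∀ (n : ℕ) (v : Matrix (Fin n) (Fin n) A),
      ‖blockOperator (v.map S)‖ ≤ O.matrixNorm n v)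
    (H : Submodule ℂ K) (hH : IsClosed (H : Set K)) (hinv : ∀ a, ∀ h ∈ H, S a h ∈ H)
    (J : E →ₗᵢ[ℂ] (K →L[ℂ] K)) (hJ₀ : ∀ w, ∀ h ∈ H, J w h = 0) (hJH : ∀ w x, J w x ∈ H)
    (hJ : ∀ T : K →L[ℂ] K, (∀ h ∈ H, T h = 0) → (∀ x, T x ∈ H) → ∃ w, J w = T) :
    ∃ P : K →L[ℂ] K, (∀ h ∈ H, P h = h) ∧ (∀ x, P x ∈ H) ∧
      ∀ a, P.comp (S a) = (S a).comp P := by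
  have hS : ∀ a, ‖S a‖ ≤ ‖a‖ := fun a => by
    have h := hcb 1 (Matrix.of fun _ _ => a)
    rw [O.matrixNorm_one] at h
    rwa [← blockOperator_unique (ι := Fin 1) (S a)]
  have : CompleteSpace H := hH.completeSpace_coe
  let P₀ : K →L[ℂ] K := H.starProjection
  have hP₀ : ∀ h ∈ H, P₀ h = h := fun h hh => Submodule.starProjection_eq_self_iff.mpr hh
  have hP₀H : ∀ x, P₀ x ∈ H := fun x => Submodule.starProjection_apply_mem _ x
  have hP₀n : ‖P₀‖ ≤ 1 := Submodule.starProjection_norm_le H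
  have hrm' : ∀ (a : A) (w : E), ∃ z, J z = (J w).comp (S a) := fun a w =>
    hJ _ (fun h hh => hJ₀ w _ (hinv a h hh)) fun x => hJH w _
  have hlm' : ∀ (a : A) (w : E), ∃ z, J z = (S a).comp (J w) := fun a w =>
    hJ _ (fun h hh => by simp [hJ₀ w h hh]) fun x => hinv a _ (hJH w x)
  -- Invariance of `H` makes the commutator with the orthogonal projection vanish on `H` and map
  -- into `H`, so the derivation takes values in `E`.
  have hδ' : ∀ a : A, ∃ z, J z = (S a).comp P₀ - P₀.comp (S a) := fun a =>
    hJ _ (fun h hh => by simp [hP₀ h hh, hP₀ _ (hinv a h hh)])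
      fun x => H.sub_mem (hinv a _ (hP₀H x)) (hP₀H _)
  choose rm' hrm' using hrm'
  choose lm' hlm' using hlm'
  choose δ' hδ' using hδ'
  let rm : A →L[ℂ] E →L[ℂ] E := LinearMap.mkContinuous₂
    (LinearMap.mk₂ ℂ rm'
      (fun a b w => J.injective (by ext; simp [hrm']))
      (fun c a w => J.injective (by ext; simp [hrm']))
      (fun a v w => J.injective (by ext; simp [hrm']))
      (fun c a w => J.injective (by ext; simp [hrm']))) 1
    (fun a w => by
      rw [one_mul, mul_comm, LinearMap.mk₂_apply, ← J.norm_map, ← J.norm_map w, hrm']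
      exact (ContinuousLinearMap.opNorm_comp_le _ _).trans
        (mul_le_mul_of_nonneg_left (hS a) (norm_nonneg _)))
  let lm : A →L[ℂ] E →L[ℂ] E := LinearMap.mkContinuous₂
    (LinearMap.mk₂ ℂ lm'
      (fun a b w => J.injective (by ext; simp [hlm']))
      (fun c a w => J.injective (by ext; simp [hlm']))
      (fun a v w => J.injective (by ext; simp [hlm']))
      (fun c a w => J.injective (by ext; simp [hlm']))) 1
    (fun a w => by
      rw [one_mul, LinearMap.mk₂_apply, ← J.norm_map, ← J.norm_map w, hlm']
      exact (ContinuousLinearMap.opNorm_comp_le _ _).trans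
        (mul_le_mul_of_nonneg_right (hS a) (norm_nonneg _)))
  have hrm : ∀ a w, J (rm a w) = (J w).comp (S a) := hrm'
  have hlm : ∀ a w, J (lm a w) = (S a).comp (J w) := hlm'
  -- The test bimodule is `E*`, so that the derivation `A → E` can be viewed in the dual bimodule
  -- `E**`; this avoids finding a predual of `E`.
  let M : BanachBimodule A (StrongDual ℂ E) :=
    { left := ((ContinuousLinearMap.compL ℂ E E ℂ).flip).comp rm
      right := ((ContinuousLinearMap.compL ℂ E E ℂ).flip).comp lm
      left_mul := fun a b v => by
        ext w
        change v (rm (a * b) w) = v (rm b (rm a w))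
        congr 1
        apply J.injective
        simp only [hrm, hmul, ContinuousLinearMap.comp_assoc]
      right_mul := fun a b v => by
        ext w
        change v (lm (a * b) w) = v (lm a (lm b w))
        congr 1
        apply J.injective
        simp only [hlm, hmul, ContinuousLinearMap.comp_assoc]
      left_right := fun a b v => by
        ext w
        change v (lm b (rm a w)) = v (rm a (lm b w))
        congr 1
        apply J.injective
        simp only [hlm, hrm, ContinuousLinearMap.comp_assoc] }
  have hMl : ∀ a v w, M.left a v w = v (rm a w) := fun a v w => rfl
  have hMr : ∀ a v w, M.right a v w = v (lm a w) := fun a v w => rfl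
  let OE := ofOperators J
  have hM : M.IsOperatorBimodule O OE.dual := by
    constructor
    · refine ⟨1, BilinearCBBound.dual_left (β := fun w a => rm a w) zero_le_one
        (bilinearCBBound_comp OE O J S (fun n v => le_rfl) hcb J _
          fun w a => hrm a w) hMl⟩
    · refine ⟨1, BilinearCBBound.dual_right (γ := fun a w => lm a w) zero_le_one
        (bilinearCBBound_comp O OE S J hcb (fun n v => le_rfl) J _
          fun a w => hlm a w) fun v a w => hMr a v w⟩
  let δ : A →ₗ[ℂ] E :=
    { toFun := δ'
      map_add' := fun a b => J.injective (by
        ext x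
        simp only [hδ', map_add, sub_apply, add_apply, ContinuousLinearMap.comp_apply]
        abel)
      map_smul' := fun c a => J.injective (by
        ext x
        simp [hδ', smul_sub]) }
  have hδ : ∀ a, J (δ a) = (S a).comp P₀ - P₀.comp (S a) := hδ'
  -- The constant 2 counts the two terms of the commutator, each bounded because the orthogonal
  -- projection is a contraction.
  have hδcb : ∀ (n : ℕ) (v : Matrix (Fin n) (Fin n) A),
      OE.matrixNorm n (v.map δ) ≤ 2 * O.matrixNorm n v := by
    intro n v
    have e : (v.map δ).map J
        = (Matrix.of fun i j => ((v.map S) i j).comp P₀)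
          + (-1 : ℂ) • Matrix.of fun i j => P₀.comp ((v.map S) i j) := by
      ext1 i j
      simp [hδ, sub_eq_add_neg]
    rw [ofOperators_matrixNorm, e]
    refine (blockOperator_norm_add_le _ _).trans ?_
    rw [blockOperator_norm_smul, norm_neg, norm_one, one_mul, two_mul]
    have h0 := blockOperator_norm_nonneg (v.map S)
    exact add_le_add
      (((blockOperator_norm_mul_const_le _ _).trans (mul_le_of_le_one_right h0 hP₀n)).trans
        (hcb n v))
      (((blockOperator_norm_const_mul_le _ _).trans (mul_le_of_le_one_left h0 hP₀n)).trans
        (hcb n v))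
  let δL : A →L[ℂ] E := δ.mkContinuous 2 fun a => by
    have h := hδcb 1 (Matrix.of fun _ _ => a)
    rw [O.matrixNorm_one] at h
    rwa [← OE.matrixNorm_one]
  let D : A →L[ℂ] StrongDual ℂ (StrongDual ℂ E) :=
    (NormedSpace.inclusionInDoubleDual ℂ E).comp δL
  have hD : ∀ a v, D a v = v (δ a) := fun a v => rfl
  obtain ⟨f, hf⟩ := hO (StrongDual ℂ E) OE.dual M hM D
    (fun a b v => by
      rw [hD, hD, hD, hMl, hMr, ← map_add]
      congr 1
      apply J.injective
      ext x
      simp [hδ, hlm, hrm, hmul])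
    (completelyBounded_bidual hδcb _ hD)
  obtain ⟨T, hT⟩ := exists_operator_of_functional J f
  -- `T` inherits the two defining properties of `E`: the vector functional of `(ξ, η)` is zero on
  -- `E` when `ξ ∈ H` or `η ⊥ H`.
  have hT0 : ∀ h ∈ H, T h = 0 := fun h hh => by
    refine ext_inner_left ℂ fun η => ?_
    rw [hT, inner_zero_right, ← map_zero f]
    congr 1
    ext w
    rw [vectorFunctional_apply, hJ₀ w h hh, inner_zero_right]
    rfl
  have hTH : ∀ x, T x ∈ H := fun x => by
    rw [← Submodule.orthogonal_orthogonal H, Submodule.mem_orthogonal]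
    intro η hη
    rw [hT, ← map_zero f]
    congr 1
    ext w
    rw [vectorFunctional_apply]
    exact Submodule.inner_left_of_mem_orthogonal (hJH w x) hη
  have hcomm : ∀ a, (S a).comp P₀ - P₀.comp (S a) = (S a).comp T - T.comp (S a) := by
    intro a
    ext ξ
    refine ext_inner_left ℂ fun η => ?_
    have h := hf a (vectorFunctional J ξ η)
    have e1 : M.right a (vectorFunctional J ξ η)
        = vectorFunctional J ξ (ContinuousLinearMap.adjoint (S a) η) := by
      ext w
      rw [hMr, vectorFunctional_apply, vectorFunctional_apply, hlm,
        ContinuousLinearMap.adjoint_inner_left]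
      rfl
    have e2 : M.left a (vectorFunctional J ξ η) = vectorFunctional J (S a ξ) η := by
      ext w
      rw [hMl, vectorFunctional_apply, vectorFunctional_apply, hrm]
      rfl
    rw [hD, vectorFunctional_apply, hδ, e1, e2, ← hT, ← hT,
      ContinuousLinearMap.adjoint_inner_left] at h
    rw [h, sub_apply, inner_sub_right]
    rfl
  -- `P₀` and `T` have the same commutators with `S a`, so their difference commutes with the
  -- action; subtracting `T` leaves the values on `H` unchanged and keeps the range in `H`.
  refine ⟨P₀ - T, fun h hh => ?_, fun x => H.sub_mem (hP₀H x) (hTH x), fun a => ?_⟩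
  · rw [sub_apply, hP₀ h hh, hT0 h hh, sub_zero]
  · rw [ContinuousLinearMap.sub_comp, ContinuousLinearMap.comp_sub]
    have := hcomm a
    rw [sub_eq_sub_iff_add_eq_add] at this ⊢
    rw [add_comm, ← this, add_comm]

/-- The operators on `K` that vanish on `H` and have range in `H`. -/
def offDiagonal (H : Submodule ℂ K) : Submodule ℂ (K →L[ℂ] K) where
  carrier := {T | (∀ h ∈ H, T h = 0) ∧ ∀ x, T x ∈ H}
  add_mem' := fun {S T} hS hT =>
    ⟨fun h hh => by simp [hS.1 h hh, hT.1 h hh], fun x => H.add_mem (hS.2 x) (hT.2 x)⟩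
  zero_mem' := ⟨fun _ _ => rfl, fun _ => H.zero_mem⟩
  smul_mem' := fun c T hT => ⟨fun h hh => by simp [hT.1 h hh], fun x => H.smul_mem c (hT.2 x)⟩

/-- If `A` is operator amenable and acts completely contractively on a Hilbert space, then every
closed invariant subspace is the range of a bounded projection that commutes with the action. -/
theorem OperatorSpaceStructure.IsOperatorAmenable.exists_commuting_projection [CompleteSpace K]
    {A : Type u} [NonUnitalNormedRing A] [NormedSpace ℂ A] {O : OperatorSpaceStructure A}
    (hO : O.IsOperatorAmenable) (S : A →ₗ[ℂ] K →L[ℂ] K)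
    (hmul : ∀ a b, S (a * b) = (S a).comp (S b))
    (hcb : ∀ (n : ℕ) (v : Matrix (Fin n) (Fin n) A),
      ‖blockOperator (v.map S)‖ ≤ O.matrixNorm n v)
    (H : Submodule ℂ K) (hH : IsClosed (H : Set K)) (hinv : ∀ a, ∀ h ∈ H, S a h ∈ H) :
    ∃ P : K →L[ℂ] K, (∀ h ∈ H, P h = h) ∧ (∀ x, P x ∈ H) ∧
      ∀ a, P.comp (S a) = (S a).comp P :=
  hO.exists_commuting_projection_aux S hmul hcb H hH hinv (offDiagonal H).subtypeₗᵢ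
    (fun w => w.2.1) (fun w => w.2.2) fun T h₁ h₂ => ⟨⟨T, h₁, h₂⟩, rfl⟩

end InvariantSubspace

/-! ### Functionals on `C(X)` are dominated by positive functionals -/

section Domination

open scoped ComplexOrder

variable {X : Type*} [TopologicalSpace X]

/-- The pairs `(k, f)` with `|f| ≤ k`. -/
def dominationCone (X : Type*) [TopologicalSpace X] : PointedCone ℝ (C(X, ℝ) × C(X, ℂ)) where
  carrier := {p | ∀ x, ‖p.2 x‖ ≤ p.1 x}
  add_mem' := fun {p q} hp hq x => (norm_add_le _ _).trans (add_le_add (hp x) (hq x))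
  zero_mem' := fun x => by simp
  smul_mem' := fun c p hp x => by
    change ‖((c : ℝ) : ℂ) * p.2 x‖ ≤ (c : ℝ) * p.1 x
    rw [norm_mul, Complex.norm_of_nonneg c.2]
    exact mul_le_mul_of_nonneg_left (hp x) c.2

theorem mem_dominationCone {p : C(X, ℝ) × C(X, ℂ)} :
    p ∈ dominationCone X ↔ ∀ x, ‖p.2 x‖ ≤ p.1 x := Iff.rfl

/-- The modulus of a continuous function. -/
def ContinuousMap.pointwiseNorm (f : C(X, ℂ)) : C(X, ℝ) := ⟨fun x => ‖f x‖, by fun_prop⟩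

variable [CompactSpace X]

/-- The functional `ψ` plays the role of the total variation of the measure `φ`, obtained without
measures. On pairs `(t, f)` with `t` constant, `‖φ‖ t - Re φ(f)` is nonnegative whenever `|f| ≤ t`.
Extend it positively by the M. Riesz theorem and evaluate on `(|f|, f)`. -/
theorem exists_real_dominating (φ : C(X, ℂ) →L[ℂ] ℂ) :
    ∃ ψ : C(X, ℝ) →ₗ[ℝ] ℝ, (∀ k, 0 ≤ k → 0 ≤ ψ k) ∧ ∀ f, ‖φ f‖ ≤ ψ f.pointwiseNorm := by
  rcases isEmpty_or_nonempty X with hX | ⟨⟨x₀⟩⟩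
  · refine ⟨0, fun _ _ => le_rfl, fun f => ?_⟩
    rw [Subsingleton.elim f 0]
    simp
  -- Evaluation at `x₀` merely reads off the constant; `F` is used only on `dom`.
  let F : C(X, ℝ) × C(X, ℂ) →ₗ[ℝ] ℝ :=
    { toFun := fun p => ‖φ‖ * p.1 x₀ - (φ p.2).re
      map_add' := fun p q => by simp; ring
      map_smul' := fun c p => by
        have : φ (c • p.2) = (c : ℂ) * φ p.2 := by
          rw [← smul_eq_mul, ← map_smul]; rfl
        simp [this]; ring }
  let dom : Submodule ℝ (C(X, ℝ) × C(X, ℂ)) :=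
    { carrier := {p | ∃ t : ℝ, p.1 = ContinuousMap.const X t}
      add_mem' := by
        rintro p q ⟨s, hs⟩ ⟨t, ht⟩
        exact ⟨s + t, by rw [Prod.fst_add, hs, ht]; rfl⟩
      zero_mem' := ⟨0, rfl⟩
      smul_mem' := by
        rintro c p ⟨t, ht⟩
        exact ⟨c * t, by rw [Prod.smul_fst, ht]; rfl⟩ }
  obtain ⟨g, hg, hpos⟩ := riesz_extension (dominationCone X) ⟨dom, F.comp dom.subtype⟩
    (by
      rintro ⟨⟨k, f⟩, t, ht⟩ hp
      change 0 ≤ ‖φ‖ * k x₀ - (φ f).re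
      have hp' : ∀ x, ‖f x‖ ≤ k x := hp
      have hk : ∀ x, k x = t := fun x => by
        have : k = ContinuousMap.const X t := ht
        rw [this]; rfl
      have hf : ‖f‖ ≤ k x₀ := by
        rw [ContinuousMap.norm_le _ ((norm_nonneg _).trans (hp' x₀))]
        intro x
        rw [hk x₀, ← hk x]
        exact hp' x
      have := (Complex.re_le_norm _).trans (φ.le_opNorm_of_le hf)
      linarith)
    -- Every pair is moved into the cone by adding a large constant in the first coordinate.
    (by
      rintro ⟨k, f⟩
      refine ⟨⟨(ContinuousMap.const X (‖f‖ + ‖k‖), 0), _, rfl⟩, ?_⟩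
      rw [mem_dominationCone]
      intro x
      change ‖0 + f x‖ ≤ ‖f‖ + ‖k‖ + k x
      rw [zero_add]
      have h1 := f.norm_coe_le_norm x
      have h2 := neg_abs_le (k x)
      have h3 := k.norm_coe_le_norm x
      rw [Real.norm_eq_abs] at h3
      linarith)
  have hg0 : ∀ f : C(X, ℂ), g (0, f) = -(φ f).re := fun f => by
    have := hg ⟨(0, f), 0, rfl⟩
    rw [this]
    change ‖φ‖ * (0 : ℝ) - (φ f).re = _
    ring
  refine ⟨g.comp (LinearMap.inl ℝ _ _), fun k hk => hpos _ ?_, fun f => ?_⟩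
  · intro x
    simpa using hk x
  · have hre : ∀ f : C(X, ℂ), (φ f).re ≤ g (f.pointwiseNorm, 0) := fun f => by
      have h : 0 ≤ g (f.pointwiseNorm, f) := hpos _ fun x => le_rfl
      have e : (f.pointwiseNorm, f) = ((f.pointwiseNorm, 0) : C(X, ℝ) × C(X, ℂ)) + (0, f) := by simp
      rw [e, map_add, hg0] at h
      linarith
    -- Rotating `f` upgrades the bound on the real part to a bound on the modulus, as `|θ f| = |f|`.
    obtain ⟨θ, hθ, h⟩ : ∃ θ : ℂ, ‖θ‖ = 1 ∧ ((‖φ f‖ : ℝ) : ℂ) = θ * φ f := by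
      obtain ⟨c, hc, h⟩ := RCLike.exists_norm_eq_mul_self (K := ℂ) (φ f)
      exact ⟨c, hc, h⟩
    have h2 := hre (θ • f)
    rw [map_smul, smul_eq_mul, ← h, Complex.ofReal_re] at h2
    have e : (θ • f).pointwiseNorm = f.pointwiseNorm := by
      ext x
      simp [ContinuousMap.pointwiseNorm, hθ]
    rwa [e] at h2

/-- A bounded functional on `C(X)` is bounded with respect to the `L²`-seminorm of some positive
functional. -/
theorem exists_positive_dominating (φ : C(X, ℂ) →L[ℂ] ℂ) :
    ∃ (ψ : C(X, ℂ) →ₚ[ℂ] ℂ) (c : ℝ), 0 ≤ c ∧ ∀ f, ‖φ f‖ ^ 2 ≤ c * (ψ (star f * f)).re := by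
  obtain ⟨ψ, hpos, hdom⟩ := exists_real_dominating φ
  let re : C(X, ℂ) → C(X, ℝ) := fun f => ⟨fun x => (f x).re, by fun_prop⟩
  let im : C(X, ℂ) → C(X, ℝ) := fun f => ⟨fun x => (f x).im, by fun_prop⟩
  let Ψ : C(X, ℂ) →ₗ[ℂ] ℂ :=
    { toFun := fun f => (ψ (re f) : ℂ) + (ψ (im f) : ℂ) * Complex.I
      map_add' := fun f g => by
        have h1 : re (f + g) = re f + re g := by ext; simp [re]
        have h2 : im (f + g) = im f + im g := by ext; simp [im]
        rw [h1, h2, map_add, map_add]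
        push_cast
        ring
      map_smul' := fun c f => by
        have h1 : re (c • f) = c.re • re f - c.im • im f := by ext; simp [re, im]
        have h2 : im (c • f) = c.re • im f + c.im • re f := by ext; simp [re, im]
        rw [h1, h2, map_add, map_sub, map_smul, map_smul, map_smul, map_smul]
        apply Complex.ext <;> simp }
  have hΨ : ∀ f, (Ψ f).re = ψ (re f) := fun f => by
    change ((ψ (re f) : ℂ) + (ψ (im f) : ℂ) * Complex.I).re = _
    simp
  have hΨim : ∀ f, (Ψ f).im = ψ (im f) := fun f => by
    change ((ψ (re f) : ℂ) + (ψ (im f) : ℂ) * Complex.I).im = _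
    simp
  refine ⟨PositiveLinearMap.mk₀ Ψ fun f hf => ?_, ψ 1, hpos _ fun x => zero_le_one, fun f => ?_⟩
  · have h : ∀ x, 0 ≤ (f x).re ∧ 0 = (f x).im := fun x => Complex.le_def.mp (hf x)
    have h2 : im f = 0 := by
      ext x
      exact (h x).2.symm
    rw [Complex.le_def, hΨ, hΨim, h2, map_zero]
    exact ⟨hpos _ fun x => (h x).1, rfl⟩
  · change _ ≤ ψ 1 * (Ψ (star f * f)).re
    rw [hΨ]
    have e : re (star f * f) = f.pointwiseNorm * f.pointwiseNorm := by
      ext x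
      simp [re, ContinuousMap.pointwiseNorm, ← sq, Complex.sq_norm, Complex.normSq_apply]
    rw [e]
    -- Cauchy–Schwarz for `ψ`: the quadratic `ψ((|f| - t)²)` is nonnegative, so its discriminant is
    -- at most zero. This is where `c = ψ 1` comes from.
    have hq : ∀ t : ℝ, 0 ≤ ψ 1 * (t * t) + (-2 * ψ f.pointwiseNorm) * t
        + ψ (f.pointwiseNorm * f.pointwiseNorm) := fun t => by
      have h := hpos ((f.pointwiseNorm - t • 1) * (f.pointwiseNorm - t • 1)) fun x => by
        simpa using mul_self_nonneg _
      have e2 : (f.pointwiseNorm - t • 1) * (f.pointwiseNorm - t • 1)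
          = f.pointwiseNorm * f.pointwiseNorm - (2 * t) • f.pointwiseNorm + (t * t) • 1 := by
        ext x
        simp
        ring
      rw [e2, map_add, map_sub, map_smul, map_smul, smul_eq_mul, smul_eq_mul] at h
      linarith
    have hd := discrim_le_zero hq
    rw [discrim] at hd
    have h1 : ‖φ f‖ ^ 2 ≤ ψ f.pointwiseNorm ^ 2 := pow_le_pow_left₀ (norm_nonneg _) (hdom f) 2
    nlinarith

end Domination

/-! ### The Gelfand–Naimark–Segal representation of `C(X)` -/

section GNS

open scoped ComplexOrder InnerProductSpace
open UniformSpace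

variable {X : Type u} [TopologicalSpace X] [CompactSpace X]

/-- The GNS representation is completely contractive. -/
theorem blockOperator_gns_norm_le (ψ : C(X, ℂ) →ₚ[ℂ] ℂ) {n : ℕ}
    (a : Matrix (Fin n) (Fin n) C(X, ℂ)) {c : ℝ} (hc : 0 ≤ c)
    (h : ∀ x, ‖a.map fun f => f x‖ ≤ c) :
    ‖blockOperator (a.map ψ.gnsNonUnitalStarAlgHom)‖ ≤ c := by
  refine blockOperator_norm_le _ hc fun y => ?_
  -- By density it suffices to test tuples of vectors that come from functions.
  have hd : DenseRange (Pi.map fun _ : Fin n => ((↑) : ψ.PreGNS → ψ.GNS)) :=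
    .piMap fun _ => Completion.denseRange_coe
  refine hd.induction_on y ?_ fun f => ?_
  · refine isClosed_le (by fun_prop) (by fun_prop)
  let g : Fin n → C(X, ℂ) := fun j => ψ.ofPreGNS (f j)
  have e1 : ∀ i, ∑ j, (a.map ψ.gnsNonUnitalStarAlgHom) i j
      (Pi.map (fun _ : Fin n => ((↑) : ψ.PreGNS → ψ.GNS)) f j)
      = ((ψ.toPreGNS (∑ j, a i j * g j) : ψ.PreGNS) : ψ.GNS) := fun i => by
    simp only [Matrix.map_apply, Pi.map_apply, PositiveLinearMap.gnsNonUnitalStarAlgHom_apply_coe,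
      PositiveLinearMap.leftMulMapPreGNS_apply, map_sum]
    rw [← Completion.coe_toComplL (𝕜 := ℂ), map_sum]
  have e2 : ∀ k : C(X, ℂ), ‖((ψ.toPreGNS k : ψ.PreGNS) : ψ.GNS)‖ ^ 2 = (ψ (star k * k)).re :=
    fun k => by
      rw [Completion.norm_coe, ← PositiveLinearMap.ofPreGNS_toPreGNS ψ k, ← Complex.ofReal_re (_ ^ 2)]
      congr 1
      push_cast
      exact ψ.preGNS_norm_sq _
  simp only [e1, e2]
  have e3 : ∀ j, ‖Pi.map (fun _ : Fin n => ((↑) : ψ.PreGNS → ψ.GNS)) f j‖ ^ 2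
      = (ψ (star (g j) * g j)).re := fun j => e2 (g j)
  simp only [e3]
  -- At each point this is the scalar matrix bound; positivity of `ψ` then integrates it.
  have hpos : 0 ≤ ((c ^ 2 : ℝ) : ℂ) • ∑ j, star (g j) * g j
      - ∑ i, star (∑ j, a i j * g j) * ∑ j, a i j * g j := by
    refine ContinuousMap.le_def.mpr fun x => ?_
    have h1 := sum_sq_mulVec_le (a.map fun f => f x) fun j => g j x
    have h2 : ‖a.map fun f => f x‖ ^ 2 ≤ c ^ 2 := pow_le_pow_left₀ (norm_nonneg _) (h x) 2
    have h3 : ∑ i, ‖∑ j, a i j x * g j x‖ ^ 2 ≤ c ^ 2 * ∑ j, ‖g j x‖ ^ 2 :=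
      h1.trans (mul_le_mul_of_nonneg_right h2 (Finset.sum_nonneg fun _ _ => by positivity))
    have h4 : ∀ z : ℂ, star z * z = ((‖z‖ ^ 2 : ℝ) : ℂ) := fun z => by
      push_cast
      exact RCLike.conj_mul z
    simp only [ContinuousMap.zero_apply, ContinuousMap.sub_apply, ContinuousMap.smul_apply,
      ContinuousMap.coe_sum, Finset.sum_apply, ContinuousMap.mul_apply, ContinuousMap.star_apply, h4, smul_eq_mul]
    rw [← Complex.ofReal_sum, ← Complex.ofReal_sum, ← Complex.ofReal_mul, ← Complex.ofReal_sub]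
    exact_mod_cast sub_nonneg.mpr h3
  have := (Complex.le_def.mp (map_nonneg ψ hpos)).1
  rw [map_sub, map_smul, map_sum, map_sum, smul_eq_mul, Complex.sub_re, Complex.re_ofReal_mul,
    Complex.re_sum, Complex.re_sum, Complex.zero_re, sub_nonneg] at this
  exact this

/-- If `min A` is operator amenable for a subalgebra `A` of `C(X)`, then `A* A` is contained in the
closure of `A`: it is annihilated by all functionals that annihilate `A`. -/
theorem apply_star_mul_eq_zero {A : Type u} [NonUnitalNormedRing A] [NormedSpace ℂ A]
    (hA : (OperatorSpaceStructure.min A).IsOperatorAmenable) (j : A →ₙₐ[ℂ] C(X, ℂ))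
    (hj : Isometry j) (φ : C(X, ℂ) →L[ℂ] ℂ) (hφ : ∀ a, φ (j a) = 0) (a b : A) :
    φ (star (j a) * j b) = 0 := by
  obtain ⟨ψ, c, hc, hψ⟩ := exists_positive_dominating φ
  let q : C(X, ℂ) →ₗ[ℂ] ψ.GNS :=
    (Completion.toComplL (𝕜 := ℂ) (E := ψ.PreGNS)).toLinearMap ∘ₗ ψ.toPreGNS.toLinearMap
  have hq : ∀ f g, ψ.gnsNonUnitalStarAlgHom f (q g) = q (f * g) := fun f g => by
    change ψ.gnsNonUnitalStarAlgHom f ((ψ.toPreGNS g : ψ.PreGNS) : ψ.GNS) = _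
    rw [PositiveLinearMap.gnsNonUnitalStarAlgHom_apply_coe]
    rfl
  have hqn : ∀ f, ‖φ f‖ ^ 2 ≤ c * ‖q f‖ ^ 2 := fun f => by
    refine (hψ f).trans (le_of_eq ?_)
    congr 1
    change _ = ‖((ψ.toPreGNS f : ψ.PreGNS) : ψ.GNS)‖ ^ 2
    rw [Completion.norm_coe, ← Complex.ofReal_re (‖_‖ ^ 2)]
    congr 1
    push_cast
    exact (ψ.preGNS_norm_sq _).symm
  let S : A →ₗ[ℂ] ψ.GNS →L[ℂ] ψ.GNS :=
    { toFun := fun a => ψ.gnsNonUnitalStarAlgHom (j a)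
      map_add' := fun a b => by rw [map_add, map_add]
      map_smul' := fun t a => by rw [map_smul, map_smul]; rfl }
  have hS : ∀ a, S a = ψ.gnsNonUnitalStarAlgHom (j a) := fun a => rfl
  let jL : A →L[ℂ] C(X, ℂ) := ⟨(j : A →ₗ[ℂ] C(X, ℂ)), hj.continuous⟩
  have hjn : ∀ a, ‖j a‖ = ‖a‖ := hj.norm_map_of_map_zero (map_zero j)
  have hcb : ∀ (n : ℕ) (v : Matrix (Fin n) (Fin n) A),
      ‖blockOperator (v.map S)‖ ≤ (OperatorSpaceStructure.min A).matrixNorm n v := by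
    intro n v
    -- Point evaluations are contractive functionals on `A`, hence dominated by the minimal norm.
    refine blockOperator_gns_norm_le ψ (v.map j) (apply_nonneg _ _) fun x => ?_
    let ev : StrongDual ℂ A := (ContinuousMap.evalCLM ℂ x).comp jL
    have hev : ‖ev‖ ≤ 1 := ContinuousLinearMap.opNorm_le_bound _ zero_le_one fun a => by
      rw [one_mul, ← hjn]
      exact (j a).norm_coe_le_norm x
    exact (OperatorSpaceStructure.norm_map_le _ v ev).trans
      (mul_le_of_le_one_left (apply_nonneg _ _) hev)
  let H : Submodule ℂ ψ.GNS := (LinearMap.range (q ∘ₗ (j : A →ₗ[ℂ] C(X, ℂ)))).topologicalClosure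
  have hH : IsClosed (H : Set ψ.GNS) := Submodule.isClosed_topologicalClosure _
  have hqH : ∀ a, q (j a) ∈ H := fun a => Submodule.le_topologicalClosure _ ⟨a, rfl⟩
  have hinv : ∀ a, ∀ h ∈ H, S a h ∈ H := by
    intro a h hh
    refine map_mem_closure (S a).continuous hh ?_
    rintro _ ⟨b, rfl⟩
    refine ⟨a * b, ?_⟩
    change q (j (a * b)) = S a (q (j b))
    rw [hS, hq, map_mul]
  obtain ⟨P, hP1, hP2, hP3⟩ := hA.exists_commuting_projection S
    (fun a b => by rw [hS, hS, hS, map_mul, map_mul]; rfl) hcb H hH hinv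
  have hnorm : IsStarNormal (S a) := ⟨by
    rw [hS, ← map_star, Commute, SemiconjBy, ← map_mul, ← map_mul, mul_comm]⟩
  -- Fuglede's theorem: an operator commuting with a normal operator commutes with its adjoint.
  -- Nothing here requires `P` to be selfadjoint.
  have hcomm : Commute P (star (S a)) := hnorm.commute_star_right (hP3 a)
  have hmem : q (star (j a) * j b) ∈ H := by
    rw [← hq, map_star, ← hS]
    have h := DFunLike.congr_fun hcomm.eq (q (j b))
    change P (star (S a) (q (j b))) = star (S a) (P (q (j b))) at h
    rw [hP1 _ (hqH b)] at h
    rw [← h]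
    exact hP2 _
  by_contra hne
  have hpos : 0 < ‖φ (star (j a) * j b)‖ ^ 2 := by positivity
  obtain ⟨ε, hε, hε2⟩ : ∃ ε : ℝ, 0 < ε ∧ c * ε ^ 2 < ‖φ (star (j a) * j b)‖ ^ 2 := by
    have ht : Filter.Tendsto (fun ε : ℝ => c * ε ^ 2) (nhdsWithin 0 (Set.Ioi 0)) (nhds 0) := by
      have : Continuous fun ε : ℝ => c * ε ^ 2 := by fun_prop
      simpa using (this.tendsto 0).mono_left nhdsWithin_le_nhds
    obtain ⟨ε, h1, h2⟩ := ((ht.eventually (gt_mem_nhds hpos)).and self_mem_nhdsWithin).exists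
    exact ⟨ε, h2, h1⟩
  -- Subtracting an element `j d` does not change the value of `φ`, while the GNS norm of the
  -- difference becomes too small for `hqn`.
  obtain ⟨_, ⟨d, rfl⟩, hd⟩ := Metric.mem_closure_iff.mp hmem ε hε
  rw [dist_eq_norm] at hd
  have h1 := hqn (star (j a) * j b - j d)
  rw [map_sub, hφ, sub_zero, map_sub] at h1
  have h2 : ‖q (star (j a) * j b) - q (j d)‖ ^ 2 ≤ ε ^ 2 :=
    pow_le_pow_left₀ (norm_nonneg _) hd.le 2
  exact absurd (h1.trans (mul_le_mul_of_nonneg_left h2 hc)) (not_le.mpr hε2)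

end GNS

/-! ### Selfadjointness of the subalgebra -/

section SelfAdjoint

/-- A closed subspace contains the vectors killed by all functionals that annihilate it. -/
theorem Submodule.mem_of_forall_dual {E : Type*} [NormedAddCommGroup E] [NormedSpace ℂ E]
    (R : Submodule ℂ E) (hR : IsClosed (R : Set E)) (x : E)
    (h : ∀ φ : StrongDual ℂ E, (∀ r ∈ R, φ r = 0) → φ x = 0) : x ∈ R := by
  by_contra hx
  obtain ⟨φ, s, hs, hsx⟩ := RCLike.geometric_hahn_banach_closed_point (𝕜 := ℂ)
    (R.restrictScalars ℝ).convex hR hx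
  have hR0 : ∀ r ∈ R, φ r = 0 := by
    intro r hr
    by_contra hne
    -- The multiple is chosen so that `φ` takes the value `s + 1` on it, beyond the separating bound
    -- `s`.
    have h1 := hs ((((s + 1 : ℝ) : ℂ) / φ r) • r) (R.smul_mem _ hr)
    rw [map_smul, smul_eq_mul, div_mul_cancel₀ _ hne] at h1
    simp at h1
    linarith
  have h0 := hs 0 R.zero_mem
  rw [h φ hR0] at hsx
  rw [map_zero] at h0
  exact lt_asymm h0 hsx

/-- Bernoulli gives `n t ≤ (1 + t)ⁿ`, and `(1 + t)ⁿ (1 - t)ⁿ = (1 - t²)ⁿ ≤ 1`. This is the decay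
rate behind the approximation of `f*` below. -/
theorem mul_one_sub_pow_le {t : ℝ} (h0 : 0 ≤ t) (h1 : t ≤ 1) (n : ℕ) :
    n * (t * ((1 - t) ^ n) ^ 2) ≤ 1 := by
  have ha : 0 ≤ (1 - t) ^ n := pow_nonneg (by linarith) n
  have hb : (1 - t) ^ n ≤ 1 := pow_le_one₀ (by linarith) (by linarith)
  have hc : 1 + n * t ≤ (1 + t) ^ n := one_add_mul_le_pow (by linarith) n
  have hd : (1 - t) ^ n * (1 + t) ^ n ≤ 1 := by
    rw [← mul_pow]
    exact pow_le_one₀ (by nlinarith) (by nlinarith)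
  have hn : 0 ≤ (n : ℝ) * t := by positivity
  calc n * (t * ((1 - t) ^ n) ^ 2) = (n * t * (1 - t) ^ n) * (1 - t) ^ n := by ring
    _ ≤ n * t * (1 - t) ^ n := mul_le_of_le_one_right (by positivity) hb
    _ ≤ (1 + t) ^ n * (1 - t) ^ n := by gcongr; linarith
    _ ≤ 1 := by rwa [mul_comm]

/-- A closed subalgebra `R` of `C(X)` such that `R* R ⊆ R` is selfadjoint. -/
theorem star_mem_of_star_mul_mem {X : Type*} [TopologicalSpace X] [CompactSpace X]
    (R : Submodule ℂ C(X, ℂ)) (hR : IsClosed (R : Set C(X, ℂ)))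
    (hmul : ∀ f ∈ R, ∀ g ∈ R, f * g ∈ R) (hstar : ∀ f ∈ R, ∀ g ∈ R, star f * g ∈ R)
    {f : C(X, ℂ)} (hf : f ∈ R) : star f ∈ R := by
  rcases eq_or_ne f 0 with rfl | hne
  · simp
  have hpos : 0 < ‖f‖ := norm_pos_iff.mpr hne
  -- Normalized to take values in `[0, 1]`.
  let b : C(X, ℂ) := (((‖f‖ ^ 2)⁻¹ : ℝ) : ℂ) • (star f * f)
  have hb : b ∈ R := R.smul_mem _ (hstar f hf f hf)
  let u : ℕ → C(X, ℂ) := fun n => star f * (1 - b) ^ n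
  -- The difference is `f*` times a polynomial in `b` without constant term, so no unit in `R` is
  -- needed.
  have hu : ∀ n, star f - u n ∈ R := by
    intro n
    induction n with
    | zero => simp [u]
    | succ n ih =>
      have e : star f - u (n + 1) = (star f - u n) + (star f * b - (star f - u n) * b) := by
        simp only [u, pow_succ]
        ring
      rw [e]
      refine R.add_mem ih (R.sub_mem ?_ (hmul _ ih _ hb))
      exact hstar f hf b hb
  -- At a point where `b = t` one has `|u n|² = ‖f‖² t (1 - t)^(2n)`, which is at most `‖f‖² / n`.
  have hnorm : ∀ n : ℕ, n * ‖u n‖ ^ 2 ≤ ‖f‖ ^ 2 := by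
    intro n
    rcases Nat.eq_zero_or_pos n with rfl | hn
    · simp
    have hn' : (0 : ℝ) < n := by exact_mod_cast hn
    have : ‖u n‖ ≤ √(‖f‖ ^ 2 / n) := by
      rw [ContinuousMap.norm_le _ (Real.sqrt_nonneg _)]
      intro x
      refine Real.le_sqrt_of_sq_le ?_
      rw [le_div_iff₀ hn']
      set t : ℝ := (‖f‖ ^ 2)⁻¹ * ‖f x‖ ^ 2 with ht
      have ht0 : 0 ≤ t := by positivity
      have ht1 : t ≤ 1 := by
        rw [ht, inv_mul_le_iff₀ (by positivity), mul_one]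
        exact pow_le_pow_left₀ (norm_nonneg _) (f.norm_coe_le_norm x) 2
      have hft : ‖f x‖ ^ 2 = ‖f‖ ^ 2 * t := by
        rw [ht]; field_simp
      have hbx : b x = (t : ℂ) := by
        change (((‖f‖ ^ 2)⁻¹ : ℝ) : ℂ) * (star (f x) * f x) = _
        have h4 : star (f x) * f x = ((‖f x‖ ^ 2 : ℝ) : ℂ) := by
          push_cast
          exact RCLike.conj_mul (f x)
        rw [h4, ht]
        push_cast
        rfl
      have hux : ‖u n x‖ = ‖f x‖ * (1 - t) ^ n := by
        change ‖star (f x) * (1 - b x) ^ n‖ = _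
        rw [hbx, norm_mul, norm_star, norm_pow, ← Complex.ofReal_one, ← Complex.ofReal_sub,
          Complex.norm_of_nonneg (by linarith)]
      rw [hux, mul_pow, hft]
      calc _ = ‖f‖ ^ 2 * (n * (t * ((1 - t) ^ n) ^ 2)) := by ring
        _ ≤ ‖f‖ ^ 2 * 1 := by gcongr; exact mul_one_sub_pow_le ht0 ht1 n
        _ = _ := mul_one _
    have h2 := pow_le_pow_left₀ (norm_nonneg _) this 2
    rw [Real.sq_sqrt (by positivity), le_div_iff₀ hn'] at h2
    linarith
  have hlim : Filter.Tendsto u Filter.atTop (nhds 0) := by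
    rw [tendsto_zero_iff_norm_tendsto_zero]
    have h1 : Filter.Tendsto (fun n : ℕ => ‖f‖ ^ 2 / n) Filter.atTop (nhds 0) :=
      tendsto_const_div_atTop_nhds_zero_nat _
    have h2 : Filter.Tendsto (fun n : ℕ => √(‖f‖ ^ 2 / n)) Filter.atTop (nhds 0) := by
      rw [← Real.sqrt_zero]
      exact (Real.continuous_sqrt.tendsto 0).comp h1
    refine squeeze_zero' (Filter.Eventually.of_forall fun _ => norm_nonneg _) ?_ h2
    filter_upwards [Filter.eventually_gt_atTop 0] with n hn
    refine Real.le_sqrt_of_sq_le ?_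
    rw [le_div_iff₀ (by exact_mod_cast hn)]
    linarith [hnorm n]
  refine hR.mem_of_tendsto (f := fun n => star f - u n) (b := Filter.atTop) ?_
    (Filter.Eventually.of_forall hu)
  simpa using hlim.const_sub (star f)

/-- The isometric embedding of a commutative C*-algebra into the continuous functions on the
character space of its unitization. -/
theorem exists_isometric_starEmbedding (B : Type u) [NonUnitalCommCStarAlgebra B] :
    ∃ (X : Type u) (_ : TopologicalSpace X) (_ : CompactSpace X) (j : B →ₙₐ[ℂ] C(X, ℂ)),
      Isometry j ∧ ∀ b, j (star b) = star (j b) := by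
  refine ⟨WeakDual.characterSpace ℂ (Unitization ℂ B), inferInstance, inferInstance,
    ((WeakDual.gelfandTransform ℂ (Unitization ℂ B) : Unitization ℂ B →ₙₐ[ℂ] _)).comp
      (Unitization.inrNonUnitalAlgHom ℂ B), ?_, fun b => ?_⟩
  · exact (gelfandTransform_isometry (Unitization ℂ B)).comp Unitization.isometry_inr
  · change WeakDual.gelfandTransform ℂ _ ((star b : B) : Unitization ℂ B) = _
    rw [Unitization.inr_star]
    exact gelfandTransform_map_star (b : Unitization ℂ B)

theorem isCommutativeCStarAlgebra_of_star_mem {B : Type u} [NonUnitalCommCStarAlgebra B]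
    (A : NonUnitalSubalgebra ℂ B) (hA : IsClosed (A : Set B)) (h : ∀ a ∈ A, star a ∈ A) :
    IsCommutativeCStarAlgebra A := by
  let A' : NonUnitalStarSubalgebra ℂ B := { A with star_mem' := fun {a} ha => h a ha }
  -- Closedness supplies the completeness needed for the C*-algebra instance on `A'`.
  have : IsClosed (A' : Set B) := hA
  exact ⟨A', inferInstance,
    { toFun := fun a => ⟨a, a.2⟩
      map_smul' := fun _ _ => rfl
      map_zero' := rfl
      map_add' := fun _ _ => rfl
      map_mul' := fun _ _ => rfl }, fun _ _ => rfl, fun a => ⟨⟨a, a.2⟩, rfl⟩⟩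

/-- A uniform algebra whose minimal structure is operator amenable is a C*-algebra. -/
theorem isCommutativeCStarAlgebra_of_isOperatorAmenable_min {B : Type u}
    [NonUnitalCommCStarAlgebra B] (A : NonUnitalSubalgebra ℂ B) (hA : IsClosed (A : Set B))
    (h : (OperatorSpaceStructure.min A).IsOperatorAmenable) : IsCommutativeCStarAlgebra A := by
  obtain ⟨X, _, _, j, hj, hjs⟩ := exists_isometric_starEmbedding B
  have : CompleteSpace A := hA.completeSpace_coe
  let jA : A →ₙₐ[ℂ] C(X, ℂ) := j.comp (NonUnitalSubalgebraClass.subtype A)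
  have hjA : Isometry jA := hj.comp isometry_subtype_coe
  let R : Submodule ℂ C(X, ℂ) := LinearMap.range (jA : A →ₗ[ℂ] C(X, ℂ))
  -- The isometric image of a complete space is closed.
  have hR : IsClosed (R : Set C(X, ℂ)) := hjA.isClosedEmbedding.isClosed_range
  refine isCommutativeCStarAlgebra_of_star_mem A hA fun a ha => ?_
  obtain ⟨c, hc⟩ : star (jA ⟨a, ha⟩) ∈ R := by
    refine star_mem_of_star_mul_mem R hR ?_ ?_ ⟨_, rfl⟩
    · rintro _ ⟨x, rfl⟩ _ ⟨y, rfl⟩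
      exact ⟨x * y, map_mul jA x y⟩
    · rintro _ ⟨x, rfl⟩ _ ⟨y, rfl⟩
      exact R.mem_of_forall_dual hR _ fun φ hφ =>
        apply_star_mul_eq_zero h jA hjA φ (fun z => hφ _ ⟨z, rfl⟩) x y
  have e : j (c : B) = j (star a) := by
    rw [hjs]
    exact hc
  rw [← hj.injective e]
  exact c.2

/-- The minimal structure turns a uniform algebra into a completely contractive Banach algebra. -/
theorem min_isCompletelyContractive_of_subalgebra {B : Type u} [NonUnitalCommCStarAlgebra B]
    (A : NonUnitalSubalgebra ℂ B) : (OperatorSpaceStructure.min A).IsCompletelyContractive := by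
  obtain ⟨X, _, _, j, hj, -⟩ := exists_isometric_starEmbedding B
  let jA : A →ₙₐ[ℂ] C(X, ℂ) := j.comp (NonUnitalSubalgebraClass.subtype A)
  have hjA : Isometry jA := hj.comp isometry_subtype_coe
  have hn : ∀ a, ‖jA a‖ = ‖a‖ := hjA.norm_map_of_map_zero (map_zero jA)
  let jL : A →L[ℂ] C(X, ℂ) := ⟨(jA : A →ₗ[ℂ] C(X, ℂ)), hjA.continuous⟩
  refine OperatorSpaceStructure.min_isCompletelyContractive
    (fun x => (ContinuousMap.evalCLM ℂ x).comp jL) (fun x => ?_) (fun x a b => ?_)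
    fun a c hc h => ?_
  · refine ContinuousLinearMap.opNorm_le_bound _ zero_le_one fun a => ?_
    rw [one_mul, ← hn]
    exact (jA a).norm_coe_le_norm x
  · change jA (a * b) x = jA a x * jA b x
    rw [map_mul]
    rfl
  · rw [← hn, ContinuousMap.norm_le _ hc]
    exact h

end SelfAdjoint

end

/-! ### The equivalence of the four conditions -/

theorem mainTheorem2 {B : Type u} [NonUnitalCommCStarAlgebra B] (A : NonUnitalSubalgebra ℂ B)
    (hA : IsClosed (A : Set B)) :
    List.TFAE
      [(OperatorSpaceStructure.min A).IsOperatorAmenable,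
        ∀ O : OperatorSpaceStructure A, O.IsCompletelyContractive → O.IsOperatorAmenable,
        IsAmenableBanachAlgebra A,
        IsCommutativeCStarAlgebra A] := by
  tfae_have 1 → 4 := isCommutativeCStarAlgebra_of_isOperatorAmenable_min A hA
  tfae_have 4 → 3 := fun h => h.isAmenable
  -- An operator bimodule is in particular a Banach bimodule, and all complete boundedness
  -- conditions are dropped.
  tfae_have 3 → 2 := fun h O _ V _ _ _ _ M _ D hD _ => h V M D hD
  tfae_have 2 → 1 := fun h => h _ (min_isCompletelyContractive_of_subalgebra A)
  tfae_finish
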